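/- **Setting.** Let $l,L>0$, $\Omega=(-l,l)\times(-L,\infty)\subset\mathbb R^2$, $\Lambda\in[0,\infty]$, and let $\mathcal H^1$, $\mathcal L^2$ be the length and area measures. Call $K\subset\mathbb R^2$ *$\mathcal H^1$-rectifiable* if $\mathcal H^1(K)<\infty$ and $\lim_{r\to0^+}\mathcal H^1(K\cap B_r(x))/(2r)=1$ for $\mathcal H^1$-a.e. $x\in K$ (sets of length zero are allowed). A *height* is an upper semicontinuous function $h:[-l,l]\to[0,\infty)$ of finite pointwise variation with $h\le\Lambda$, and $S_h=\{(x,y):-l\le x\le l,\ y\le h(x)\}$. A *crack set* for $h$ is a closed $\mathcal H^1$-rectifiable set $K\subset\overline\Omega\cap\overline{\mathrm{Int}(S_h)}$. For such a pair put $S_{h,K}=(S_h\setminus K)\cap\overline\Omega$. For $\alpha\ge1$, $\mathcal B^\alpha$ is the family of tuples $(S_{h^\alpha,K^\alpha},\dots,S_{h^0,K^0})$ of such sets with $h^{i-1}\le h^i$ and $\partial S_{h^i,K^i}\cap\mathrm{Int}(S_{h^{i-1},K^{i-1}})=\emptyset$ for $i=1,\dots,\alpha$. For $\mathbf m=(m_0,\dots,m_\alpha)\in\mathbb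 N^{\alpha+1}$, $\mathcal B^\alpha_{\mathbf m}$ is the subfamily for which $\partial S_{h^i,K^i}$ has at most $m_i$ connected components for every $i$. Let $\mathrm{sdist}(x,\partial E)=\mathrm{dist}(x,E)$ for $x\notin E$ and $-\mathrm{dist}(x,\mathbb R^2\setminus E)$ for $x\in E$. A sequence $(S^\alpha_k,\dots,S^0_k)\in\mathcal B^\alpha$ *$\tau_{\mathcal B^\alpha}$-converges* to $(S^\alpha,\dots,S^0)\in\mathcal B^\alpha$ if, for every $i=0,\dots,\alpha$, $\sup_k\mathcal H^1(\partial S^i_k)<\infty$ and $\mathrm{sdist}(\cdot,\partial S^i_k)\to\mathrm{sdist}(\cdot,\partial S^i)$ locally uniformly in $\mathbb R^2$. Let $\varphi_j$ $(0\le j\le\alpha)$ and $\varphi_{ij}$ $(0\le i<j\le\alpha)$ be functions on $\overline\Omega\times\mathbb R^2$, and put $\varphi^1_{ij}=\min\{\varphi_i,\varphi_j+\varphi_{ij}\}$, $\varphi^2_{ij}=\min\{\varphi_i,\varphi_j\}$. Assume that $\varphi_j,\varphi_{ij},\varphi^1_{ij},\varphi^2_{ij}$ are Finsler norms (continuous,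 and a norm in the second variable), and that there are $c_2\ge c_1>0$ with $c_1|\xi|\le\varphi_j(x,\xi),\varphi_{ij}(x,\xi),\varphi^1_{ij}(x,\xi)\le c_2|\xi|$ for all $x\in\overline\Omega$, $\xi\in\mathbb R^2$. For $i<j$, with $S^i$ and $S^j$ the $i$th and $j$th composites of an element of $\mathcal B^\alpha$, let $$\mathcal S^{(i,j)}(S^j,S^i)=\int_{\Omega\cap(\partial S^i\cup\partial S^j)}\psi_{i,j}\,d\mathcal H^1 ,$$ where, with $\partial^*$ the reduced boundary, $E^{(a)}$ the set of points of density $a$, and $\nu_E$ the unit normal to $\partial E$ (the measure-theoretic outer normal on $\partial^*E$, a normal to the approximate tangent line of $\partial E$ elsewhere), $\psi_{i,j}(x)$ equals - $\varphi_j(x,\nu_{S^j})$ on $\partial^*S^j\setminus\partial^*S^i$, - $\varphi^1_{ij}(x,\nu_{S^j})$ on $\partial^*S^i\cap\partial^*S^j$, - $\varphi_{ij}(x,\nu_{S^i})$ on $\partial^*S^i\setminus\partial S^j$, - $(\varphi_j+\varphi^1_{ij})(x,\nu_{S^j})$ on $\partial^*S^i\cap\partial S^j\cap (S^j)^{(1)}$,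 - $2\varphi_j(x,\nu_{S^j})$ on $\partial S^j\cap (S^j)^{(1)}\cap (S^i)^{(0)}$, - $2\varphi^2_{ij}(x,\nu_{S^j})$ on $\partial S^j\cap (S^j)^{(0)}$, - $2\varphi_{ij}(x,\nu_{S^i})$ on $(\partial S^i\setminus\partial S^j)\cap((S^i)^{(1)}\cup (S^i)^{(0)})\cap (S^j)^{(1)}$, - $\varphi^1_{ij}(x,\nu_{S^j})$ on $\partial S^i\cap\partial S^j\cap (S^i)^{(1)}$ (these regions cover the domain of integration up to an $\mathcal H^1$-null set). Finally let $\mathcal S^\alpha_s=\sum_{j=1}^\alpha\mathcal S^{(j-1,j)}(S^j,S^{j-1})$ and $\mathcal S^\alpha_t=\sum_{j=1}^\alpha\sum_{i=0}^{j-1}\mathcal S^{(i,j)}(S^j,S^i)$. **Proposition (compactness of $\mathcal B^\alpha_{\mathbf m}$).** Let $\alpha\ge1$, $\mathbf m\in\mathbb N^{\alpha+1}$, $\sigma\in\{s,t\}$, and let $\{(S^\alpha_k,\dots,S^0_k)\}_{k\in\mathbb N}\subset\mathcal B^\alpha_{\mathbf m}$ satisfy $$\sup_{k}\Big(\mathcal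 S^\alpha_\sigma(S^\alpha_k,\dots,S^0_k)+\mathcal L^2(S^\alpha_k)\Big)<\infty .$$ If $\Lambda=\infty$, assume also that the top composites have no filaments on the lateral walls, i.e. $S^\alpha_k\subset\overline{S^\alpha_k\cap\Omega}$ for every $k$. Then there are a subsequence and an element $(S^\alpha,\dots,S^0)\in\mathcal B^\alpha_{\mathbf m}$ to which the subsequence $\tau_{\mathcal B^\alpha}$-converges. -/

import Mathlib

open Set Filter Topology MeasureTheory
open scoped ENNReal

namespace Multilayer

/-- The plane `ℝ²` with its Euclidean norm. -/
abbrev Plane : Type := EuclideanSpace ℝ (Fin 2)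

/-! ### Measure-theoretic notions -/

/-- The one-dimensional Hausdorff measure `ℋ¹` of the plane. -/
noncomputable abbrev H1 : Measure Plane := Measure.hausdorffMeasure 1

/-- `B^(a)`: the points at which `B` has Lebesgue density `a`. -/
def densityPoints (B : Set Plane) (a : ℝ≥0∞) : Set Plane :=
  {x | Tendsto (fun r : ℝ => volume (B ∩ Metric.ball x r) / volume (Metric.ball x r))
    (𝓝[>] 0) (𝓝 a)}

/-- `K` has finite length, and its lower and upper one-dimensional densities are both equal to `1`
at `ℋ¹`-almost every point of `K`. Sets of length zero, such as the empty set, are included. -/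
def IsH1Rectifiable (K : Set Plane) : Prop :=
  H1 K < ⊤ ∧ ∀ᵐ x ∂(H1.restrict K),
    Tendsto (fun r : ℝ => H1 (K ∩ Metric.ball x r) / ENNReal.ofReal (2 * r)) (𝓝[>] 0) (𝓝 1)

/-- `E` has finite perimeter and its distributional derivative is `D 𝟙_E = η μ`, where `μ` is the
total variation `|D 𝟙_E|` (a finite measure) and `η` is a field of unit vectors. -/
structure IsPerimeterPair (E : Set Plane) (μ : Measure Plane) (η : Plane → Plane) : Prop where
  finite : IsFiniteMeasure μ
  measurable : Measurable η
  unit : ∀ᵐ x ∂μ, ‖η x‖ = 1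
  grad : ∀ f : Plane → ℝ, ContDiff ℝ (⊤ : ℕ∞) f → HasCompactSupport f → ∀ v : Plane,
    ∫ x in E, fderiv ℝ f x v = - ∫ x, f x * inner ℝ (η x) v ∂μ

/-- `ν = - lim_{r → 0} D 𝟙_E (B_r(x)) / |D 𝟙_E| (B_r(x))` exists and is a unit vector: `ν` is the
measure-theoretic outer unit normal to `E` at `x`. -/
def IsOuterNormal (E : Set Plane) (x ν : Plane) : Prop :=
  ‖ν‖ = 1 ∧ ∃ (μ : Measure Plane) (η : Plane → Plane), IsPerimeterPair E μ η ∧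
    Tendsto (fun r : ℝ => -((μ (Metric.ball x r)).toReal⁻¹ • ∫ y in Metric.ball x r, η y ∂μ))
      (𝓝[>] 0) (𝓝 ν)

/-- The reduced boundary `∂* E`. -/
def reducedBoundary (E : Set Plane) : Set Plane := {x | ∃ ν, IsOuterNormal E x ν}

/-- The unit vector `ν` is orthogonal to the approximate tangent line of `M` at `x`: `M` has
positive upper density at `x`, and the part of `M` near `x` that lies outside any cone around the
line `x + ν^⊥` has density zero. Such a `ν` is unique up to its sign. -/
def IsApproxNormal (M : Set Plane) (x ν : Plane) : Prop :=
  ‖ν‖ = 1 ∧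
  0 < limsup (fun r : ℝ => H1 (M ∩ Metric.ball x r) / ENNReal.ofReal (2 * r)) (𝓝[>] 0) ∧
  ∀ ε : ℝ, 0 < ε →
    Tendsto (fun r : ℝ =>
      H1 (M ∩ Metric.ball x r ∩ {y | ε * ‖y - x‖ < |inner ℝ (y - x) ν|}) / ENNReal.ofReal (2 * r))
      (𝓝[>] 0) (𝓝 0)

open Classical in
/-- The normal `ν_E` at a boundary point: the measure-theoretic outer normal on `∂* E`, and
elsewhere a unit normal to the approximate tangent line of `∂E`. For the sets considered here one
of the two exists at `ℋ¹`-almost every point of `∂E`; the value at the other points, for which some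
unit vector is taken, is immaterial. -/
noncomputable def normal (E : Set Plane) (x : Plane) : Plane :=
  if h : ∃ ν, IsOuterNormal E x ν then h.choose
  else if h' : ∃ ν, IsApproxNormal (frontier E) x ν then h'.choose
  else EuclideanSpace.single 1 1

open Classical in
/-- The signed distance from `∂E`: the distance from `E` outside `E`, and minus the distance from
the complement of `E` in `E`. -/
noncomputable def sdist (E : Set Plane) (x : Plane) : ℝ :=
  if x ∈ E then - Metric.infDist x Eᶜ else Metric.infDist x E

/-! ### Admissible composites -/

/-- `Ω = (-l, l) × (-L, ∞)`. -/
def Omega (l L : ℝ) : Set Plane := {p | -l < p 0 ∧ p 0 < l ∧ -L < p 1}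

/-- The admissible heights `h : [-l, l] → [0, Λ]` (`[0, ∞)` if `Λ = ∞`): upper semicontinuous
functions with finite pointwise variation. Only the values on `[-l, l]` matter. -/
def IsHeight (l : ℝ) (Λ : ℝ≥0∞) (h : ℝ → ℝ) : Prop :=
  (∀ x ∈ Icc (-l) l, 0 ≤ h x ∧ ENNReal.ofReal (h x) ≤ Λ) ∧
  UpperSemicontinuousOn h (Icc (-l) l) ∧ BoundedVariationOn h (Icc (-l) l)

/-- The closed subgraph `S_h` of a height. -/
def subgraph (l : ℝ) (h : ℝ → ℝ) : Set Plane := {p | -l ≤ p 0 ∧ p 0 ≤ l ∧ p 1 ≤ h (p 0)}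

/-- The admissible cracks: closed, `ℋ¹`-rectifiable subsets of `closure Ω` of finite length. -/
def IsCrack (l L : ℝ) (K : Set Plane) : Prop :=
  K ⊆ closure (Omega l L) ∧ IsClosed K ∧ IsH1Rectifiable K

/-- The admissible pairs of a height and a crack set, `K ⊆ closure (Int S_h)`. -/
def IsHeightCrack (l L : ℝ) (Λ : ℝ≥0∞) (h : ℝ → ℝ) (K : Set Plane) : Prop :=
  IsHeight l Λ h ∧ IsCrack l L K ∧ K ⊆ closure (interior (subgraph l h))

/-- The generalized subgraph `S_{h,K}` with height `h` and cracks `K`. -/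
def crackedSubgraph (l L : ℝ) (h : ℝ → ℝ) (K : Set Plane) : Set Plane :=
  (subgraph l h \ K) ∩ closure (Omega l L)

/-- The family of admissible subgraphs. -/
def admissibleSubgraphs (l L : ℝ) (Λ : ℝ≥0∞) : Set (Set Plane) :=
  {S | ∃ h K, IsHeightCrack l L Λ h K ∧ S = crackedSubgraph l L h K}

/-- `(S₁, S₀) ∈ ℬ¹`. -/
def IsTwoLayer (l L : ℝ) (Λ : ℝ≥0∞) (S₁ S₀ : Set Plane) : Prop :=
  ∃ h₁ K₁ h₀ K₀, IsHeightCrack l L Λ h₁ K₁ ∧ IsHeightCrack l L Λ h₀ K₀ ∧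
    S₁ = crackedSubgraph l L h₁ K₁ ∧ S₀ = crackedSubgraph l L h₀ K₀ ∧
    (∀ x ∈ Icc (-l) l, h₀ x ≤ h₁ x) ∧ frontier S₁ ∩ interior S₀ = ∅

/-- `ℬ^α`: tuples of composites `(S_α, …, S_0)`, with `S_i` stored at the index `i`. -/
def multilayers (l L : ℝ) (Λ : ℝ≥0∞) (α : ℕ) : Set (Fin (α + 1) → Set Plane) :=
  {S | (∀ i, S i ∈ admissibleSubgraphs l L Λ) ∧
    ∀ i : Fin α, IsTwoLayer l L Λ (S i.succ) (S i.castSucc)}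

/-- `ℬ^α_m`: the boundary of `S_i` has at most `m_i` connected components. -/
def connMultilayers (l L : ℝ) (Λ : ℝ≥0∞) (α : ℕ) (m : Fin (α + 1) → ℕ) :
    Set (Fin (α + 1) → Set Plane) :=
  {S | S ∈ multilayers l L Λ α ∧
    ∀ i, ENat.card (ConnectedComponents (frontier (S i))) ≤ (m i : ℕ∞)}

/-- `τ_{ℬ^α}`-convergence. -/
def TauConverges {α : ℕ} (S : ℕ → Fin (α + 1) → Set Plane) (T : Fin (α + 1) → Set Plane) : Prop :=
  (∀ i, (⨆ k, H1 (frontier (S k i))) < ⊤) ∧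
  ∀ i, TendstoLocallyUniformly (fun k => sdist (S k i)) (sdist (T i)) atTop

/-! ### Surface energies -/

/-- `φ¹_{ij} = min {φ_i, φ_j + φ_{ij}}`. -/
noncomputable def tension1 (φi φj φij : Plane → Plane → ℝ) (x ξ : Plane) : ℝ :=
  min (φi x ξ) (φj x ξ + φij x ξ)

/-- `φ²_{ij} = min {φ_i, φ_j}`. -/
noncomputable def tension2 (φi φj : Plane → Plane → ℝ) (x ξ : Plane) : ℝ :=
  min (φi x ξ) (φj x ξ)

open Classical in
/-- The surface tension `ψ_{ij}` of the pair of composites `(Sj, Si)`, with the normal inserted. For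
a pair in `ℬ¹` the eight regions are disjoint and cover `Ω ∩ (∂Si ∪ ∂Sj)` up to an `ℋ¹`-null set;
the last one, `∂Si ∩ ∂Sj ∩ Si^(1)`, is written as the default case. -/
noncomputable def psi (φi φj φij : Plane → Plane → ℝ) (Sj Si : Set Plane) (x : Plane) : ℝ :=
  if x ∈ reducedBoundary Sj \ reducedBoundary Si then
    φj x (normal Sj x)
  else if x ∈ reducedBoundary Si ∩ reducedBoundary Sj then
    tension1 φi φj φij x (normal Sj x)
  else if x ∈ reducedBoundary Si \ frontier Sj then
    φij x (normal Si x)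
  else if x ∈ reducedBoundary Si ∩ frontier Sj ∩ densityPoints Sj 1 then
    φj x (normal Sj x) + tension1 φi φj φij x (normal Sj x)
  else if x ∈ frontier Sj ∩ densityPoints Sj 1 ∩ densityPoints Si 0 then
    2 * φj x (normal Sj x)
  else if x ∈ frontier Sj ∩ densityPoints Sj 0 then
    2 * tension2 φi φj x (normal Sj x)
  else if x ∈ (frontier Si \ frontier Sj) ∩ (densityPoints Si 1 ∪ densityPoints Si 0) ∩
      densityPoints Sj 1 then
    2 * φij x (normal Si x)
  else
    tension1 φi φj φij x (normal Sj x)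

/-- The pairwise contribution `𝒮^{(i,j)}(Sj, Si)`, the integral of `ψ_{ij}` with respect to `ℋ¹`
over `Ω ∩ (∂Si ∪ ∂Sj)`. -/
noncomputable def pairEnergy (l L : ℝ) (φi φj φij : Plane → Plane → ℝ) (Sj Si : Set Plane) :
    ℝ≥0∞ :=
  ∫⁻ x in Omega l L ∩ (frontier Si ∪ frontier Sj), ENNReal.ofReal (psi φi φj φij Sj Si x) ∂H1

/-- `σ ∈ {s, t}`. -/
inductive Interaction where
  | sequential
  | total

/-- The `α`-layered surface energy `𝒮^α_σ`, for the tensions `φ j` of the `j`th layer with vapor and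
`φφ i j`, `i < j`, of the interface between the `i`th and the `j`th layer. -/
noncomputable def surfaceEnergy (l L : ℝ) {α : ℕ} (φ : Fin (α + 1) → Plane → Plane → ℝ)
    (φφ : Fin (α + 1) → Fin (α + 1) → Plane → Plane → ℝ) (σ : Interaction)
    (S : Fin (α + 1) → Set Plane) : ℝ≥0∞ :=
  match σ with
  | .sequential => ∑ j : Fin α,
      pairEnergy l L (φ j.castSucc) (φ j.succ) (φφ j.castSucc j.succ) (S j.succ) (S j.castSucc)
  | .total => ∑ j : Fin (α + 1), ∑ i ∈ Finset.univ.filter (fun i => i < j),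
      pairEnergy l L (φ i) (φ j) (φφ i j) (S j) (S i)

/-- `φ` is a Finsler norm on `A`: it is continuous on `A × ℝ²`, and `φ(x, ·)` is a norm for
every `x ∈ A`. -/
def IsFinslerNorm (A : Set Plane) (φ : Plane → Plane → ℝ) : Prop :=
  ContinuousOn (fun p : Plane × Plane => φ p.1 p.2) (A ×ˢ univ) ∧
  ∀ x ∈ A, (∀ ξ, 0 ≤ φ x ξ) ∧ (∀ ξ, φ x ξ = 0 → ξ = 0) ∧
    (∀ (t : ℝ) (ξ : Plane), φ x (t • ξ) = |t| * φ x ξ) ∧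
    ∀ ξ ζ, φ x (ξ + ζ) ≤ φ x ξ + φ x ζ

/-- `c₁ |ξ| ≤ φ(x, ξ) ≤ c₂ |ξ|` for all `x ∈ A` and all `ξ`. -/
def HasBounds (A : Set Plane) (c₁ c₂ : ℝ) (φ : Plane → Plane → ℝ) : Prop :=
  ∀ x ∈ A, ∀ ξ : Plane, c₁ * ‖ξ‖ ≤ φ x ξ ∧ φ x ξ ≤ c₂ * ‖ξ‖

/-- The standing assumption on the surface tensions: `φ_j`, `φ_{ij}`, `φ¹_{ij}`, `φ²_{ij}` are Finsler
norms on `closure Ω`, and the first three are uniformly comparable with the Euclidean norm. -/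
structure AdmissibleTensions (l L : ℝ) {α : ℕ} (φ : Fin (α + 1) → Plane → Plane → ℝ)
    (φφ : Fin (α + 1) → Fin (α + 1) → Plane → Plane → ℝ) : Prop where
  vapor : ∀ j, IsFinslerNorm (closure (Omega l L)) (φ j)
  interface : ∀ i j, i < j → IsFinslerNorm (closure (Omega l L)) (φφ i j)
  regime1 : ∀ i j, i < j →
    IsFinslerNorm (closure (Omega l L)) (tension1 (φ i) (φ j) (φφ i j))
  regime2 : ∀ i j, i < j → IsFinslerNorm (closure (Omega l L)) (tension2 (φ i) (φ j))
  bounds : ∃ c₁ c₂ : ℝ, 0 < c₁ ∧ c₁ ≤ c₂ ∧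
    (∀ j, HasBounds (closure (Omega l L)) c₁ c₂ (φ j)) ∧
    (∀ i j, i < j → HasBounds (closure (Omega l L)) c₁ c₂ (φφ i j) ∧
      HasBounds (closure (Omega l L)) c₁ c₂ (tension1 (φ i) (φ j) (φφ i j)))

end Multilayer

namespace Multilayer

/-! ### Kuratowski convergence of sequences of sets -/

/-! Every value of the surface tension at a unit normal is at least a positive constant `c`, so the
energy bounds the length in `Ω` of the boundary of each composite. Together with the area bound (or
a finite `Λ`) this confines all composites to one compact box, and the walls of that box add only
finite length (`exists_uniform_bounds`).

The signed distance of `S` is the distance to `closure S` minus the distance to `(interior S)ᶜ`. It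
therefore suffices to extract Kuratowski limits `A` of the closures and `C` of the complements of
the interiors, and to build an admissible `T` with closure `A` and interior `Cᶜ`
(`exists_tauConverges_subseq`). Its boundary is `A ∩ C`, which is the limit of the boundaries
because closed sets covering the plane cannot come close to each other without meeting
(`KuratowskiLim.inter`).

The bound on the number of components enters here: each boundary is a union of `m i` connected
pieces, whose limits are continua with union `A ∩ C`. They have finite length
(`KuratowskiLim.hausdorffMeasure_ne_top`, a crude form of Gołąb's theorem). Every subset of a finite
union of such continua is rectifiable (`isH1Rectifiable_of_subset_iUnion`): almost every point of a
continuum of finite length is interior to an arc, which gives lower density at least `1`, while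
upper density at most `1` is a general covering fact. Finally `A` is a subgraph, whose height has
bounded variation because the boundary has finite length; the crack is the part of `A ∩ C` in the
closure of the interior of this subgraph. -/

/-- The sets `E k` converge to `F` in the sense of Kuratowski. -/
def KuratowskiLim {X : Type*} [TopologicalSpace X] (E : ℕ → Set X) (F : Set X) : Prop :=
  (∀ x ∈ F, ∀ U ∈ 𝓝 x, ∀ᶠ k in atTop, (E k ∩ U).Nonempty) ∧
  ∀ x ∉ F, ∃ U ∈ 𝓝 x, ∀ᶠ k in atTop, E k ∩ U = ∅

/-- A set is encoded by the basic open sets that it meets, which gives a point of the sequentially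
compact space `ι × B → Bool`. One extraction serves all indices at once. -/
theorem exists_subseq_kuratowskiLim {X ι : Type*} [TopologicalSpace X] [SecondCountableTopology X]
    [Countable ι] (E : ℕ → ι → Set X) :
    ∃ (θ : ℕ → ℕ) (F : ι → Set X), StrictMono θ ∧
      ∀ i, KuratowskiLim (fun k => E (θ k) i) (F i) := by
  classical
  let B := TopologicalSpace.countableBasis X
  have hB : TopologicalSpace.IsTopologicalBasis B := TopologicalSpace.isBasis_countableBasis X
  have : Countable B := (TopologicalSpace.countable_countableBasis X).to_subtype
  let f : ℕ → (ι × B → Bool) := fun k q => decide ((E k q.1 ∩ q.2.1).Nonempty)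
  obtain ⟨g, θ, hθ, hg⟩ := CompactSpace.tendsto_subseq f
  rw [tendsto_pi_nhds] at hg
  have hev : ∀ q : ι × B, ∀ᶠ k in atTop, f (θ k) q = g q := fun q => by
    have := hg q
    rw [nhds_discrete, tendsto_pure] at this
    exact this
  refine ⟨θ, fun i => {x | ∀ U : B, x ∈ U.1 → g (i, U) = true}, hθ, fun i => ⟨?_, ?_⟩⟩
  · intro x hx U hU
    obtain ⟨V, hV, hxV, hVU⟩ := hB.mem_nhds_iff.1 hU
    filter_upwards [hev (i, ⟨V, hV⟩)] with k hk
    rw [hx ⟨V, hV⟩ hxV] at hk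
    have : (E (θ k) i ∩ V).Nonempty := by simpa [f] using hk
    exact this.mono (inter_subset_inter_right _ hVU)
  · intro x hx
    simp only [mem_ofPred_eq, not_forall] at hx
    obtain ⟨U, hxU, hU⟩ := hx
    refine ⟨U.1, (hB.isOpen U.2).mem_nhds hxU, ?_⟩
    filter_upwards [hev (i, U)] with k hk
    rw [Bool.not_eq_true] at hU
    rw [hU] at hk
    have : ¬ (E (θ k) i ∩ U.1).Nonempty := by simpa [f] using hk
    exact not_nonempty_iff_eq_empty.1 this

namespace KuratowskiLim

section Topological
variable {X : Type*} [TopologicalSpace X] {E : ℕ → Set X} {F : Set X}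

theorem isClosed (h : KuratowskiLim E F) : IsClosed F := by
  rw [← isOpen_compl_iff, isOpen_iff_mem_nhds]
  intro x hx
  obtain ⟨U, hU, hE⟩ := h.2 x hx
  obtain ⟨V, hVU, hV, hxV⟩ := mem_nhds_iff.1 hU
  refine mem_of_superset (hV.mem_nhds hxV) fun y hy hyF => ?_
  obtain ⟨k, h1, h2⟩ := ((h.1 y hyF V (hV.mem_nhds hy)).and hE).exists
  obtain ⟨z, hz, hzV⟩ := h1
  exact (h2 ▸ (⟨hz, hVU hzV⟩ : z ∈ E k ∩ U) : z ∈ (∅ : Set X))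

theorem subset (h : KuratowskiLim E F) {Q : Set X} (hQ : IsClosed Q) (hE : ∀ k, E k ⊆ Q) :
    F ⊆ Q := by
  intro x hx
  by_contra hxQ
  obtain ⟨k, z, hz, hzQ⟩ := (h.1 x hx Qᶜ (hQ.isOpen_compl.mem_nhds hxQ)).exists
  exact hzQ (hE k hz)

theorem mono {E' : ℕ → Set X} {F' : Set X} (h : KuratowskiLim E F) (h' : KuratowskiLim E' F')
    (hE : ∀ k, E k ⊆ E' k) : F ⊆ F' := by
  intro x hx
  by_contra hxF
  obtain ⟨U, hU, hev⟩ := h'.2 x hxF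
  obtain ⟨k, ⟨z, hz, hzU⟩, h2⟩ := ((h.1 x hx U hU).and hev).exists
  exact (h2 ▸ (⟨hE k hz, hzU⟩ : z ∈ E' k ∩ U) : z ∈ (∅ : Set X))

theorem subset_of_forall_subset (h : KuratowskiLim E F) {Z : Set X} (hE : ∀ k, Z ⊆ E k) :
    Z ⊆ F := by
  intro x hx
  by_contra hxF
  obtain ⟨U, hU, hev⟩ := h.2 x hxF
  obtain ⟨k, h2⟩ := hev.exists
  exact (h2 ▸ (⟨hE k hx, mem_of_mem_nhds hU⟩ : x ∈ E k ∩ U) : x ∈ (∅ : Set X))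

theorem eventually_disjoint (h : KuratowskiLim E F) {Z : Set X} (hZ : IsCompact Z)
    (hd : Disjoint Z F) : ∀ᶠ k in atTop, E k ∩ Z = ∅ := by
  refine hZ.induction_on (p := fun Z => ∀ᶠ k in atTop, E k ∩ Z = ∅) (by simp) ?_ ?_ ?_
  · intro s t hst ht
    filter_upwards [ht] with k hk
    exact subset_empty_iff.1 (hk ▸ inter_subset_inter_right _ hst)
  · intro s t hs ht
    filter_upwards [hs, ht] with k hk hk'
    rw [inter_union_distrib_left, hk, hk', empty_union]
  · intro x hx
    obtain ⟨U, hU, hev⟩ := h.2 x (fun hxF => disjoint_left.1 hd hx hxF)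
    exact ⟨U, mem_nhdsWithin_of_mem_nhds hU, hev⟩

theorem nonempty (h : KuratowskiLim E F) {Q : Set X} (hQ : IsCompact Q) (hE : ∀ k, E k ⊆ Q)
    (hne : ∀ k, (E k).Nonempty) : F.Nonempty := by
  by_contra hF
  rw [not_nonempty_iff_eq_empty] at hF
  obtain ⟨k, hk⟩ := (h.eventually_disjoint hQ (by simp [hF])).exists
  obtain ⟨z, hz⟩ := hne k
  exact (hk ▸ (⟨hz, hE k hz⟩ : z ∈ E k ∩ Q) : z ∈ (∅ : Set X))

/-- Two disjoint closed parts of `F` have disjoint open neighbourhoods. What remains of `Q` is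
compact and misses `F`, so `E k` eventually avoids it and would be disconnected. -/
theorem isPreconnected [T2Space X] (h : KuratowskiLim E F) {Q : Set X} (hQ : IsCompact Q)
    (hE : ∀ k, E k ⊆ Q) (hc : ∀ k, IsPreconnected (E k)) : IsPreconnected F := by
  have hFQ : F ⊆ Q := h.subset hQ.isClosed hE
  have hF : IsCompact F := hQ.of_isClosed_subset h.isClosed hFQ
  rw [isPreconnected_iff_subset_of_fully_disjoint_closed h.isClosed]
  intro u v hu hv huv hd
  by_contra hcon
  rw [not_or, not_subset, not_subset] at hcon
  obtain ⟨⟨x, hxF, hxu⟩, ⟨y, hyF, hyv⟩⟩ := hcon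
  have hxv : x ∈ v := (huv hxF).resolve_left hxu
  have hyu : y ∈ u := (huv hyF).resolve_right hyv
  obtain ⟨U, V, hU, hV, hFU, hFV, hUV⟩ := SeparatedNhds.of_isCompact_isCompact
    (hF.inter_right hu) (hF.inter_right hv) (hd.mono inter_subset_right inter_subset_right)
  have h1 := h.1 x hxF V (hV.mem_nhds (hFV ⟨hxF, hxv⟩))
  have h2 := h.1 y hyF U (hU.mem_nhds (hFU ⟨hyF, hyu⟩))
  have h3 := h.eventually_disjoint (hQ.diff (hU.union hV)) (by
    rw [disjoint_left]
    rintro z ⟨_, hz⟩ hzF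
    rcases huv hzF with hzu | hzv
    · exact hz (Or.inl (hFU ⟨hzF, hzu⟩))
    · exact hz (Or.inr (hFV ⟨hzF, hzv⟩)))
  obtain ⟨k, h1, h2, h3⟩ := (h1.and (h2.and h3)).exists
  have hsub : E k ⊆ U ∪ V := by
    intro z hz
    by_contra hzn
    exact (h3 ▸ (⟨hz, hE k hz, hzn⟩ : z ∈ E k ∩ (Q \ (U ∪ V))) : z ∈ (∅ : Set X))
  obtain ⟨z, _, hzU, hzV⟩ := hc k U V hU hV hsub h2 h1
  exact disjoint_left.1 hUV hzU hzV

theorem iUnion {ι : Type*} [Finite ι] {E : ℕ → ι → Set X} {F : ι → Set X} {G : ℕ → Set X}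
    {H : Set X} (h : ∀ i, KuratowskiLim (fun k => E k i) (F i)) (hG : KuratowskiLim G H)
    (hE : ∀ k, G k = ⋃ i, E k i) : H = ⋃ i, F i := by
  refine Subset.antisymm (fun x hx => ?_)
    (iUnion_subset fun i => (h i).mono hG fun k => hE k ▸ subset_iUnion _ i)
  by_contra hxF
  simp only [mem_iUnion, not_exists] at hxF
  choose U hU hev using fun i => (h i).2 x (hxF i)
  obtain ⟨k, ⟨z, hz, hzU⟩, h2⟩ :=
    ((hG.1 x hx (⋂ i, U i) (iInter_mem.2 hU)).and (eventually_all.2 hev)).exists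
  rw [hE k] at hz
  obtain ⟨i, hi⟩ := mem_iUnion.1 hz
  exact (h2 i ▸ (⟨hi, mem_iInter.1 hzU i⟩ : z ∈ E k i ∩ U i) : z ∈ (∅ : Set X))

end Topological

theorem tendsto_infDist {X : Type*} [MetricSpace X] [ProperSpace X] {E : ℕ → Set X} {F : Set X}
    (h : KuratowskiLim E F) (hF : F.Nonempty) (x : X) :
    Tendsto (fun k => Metric.infDist x (E k)) atTop (𝓝 (Metric.infDist x F)) := by
  obtain ⟨p, hp, hpd⟩ := h.isClosed.exists_infDist_eq_dist hF x
  rw [Metric.tendsto_atTop']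
  intro ε hε
  have h1 := h.1 p hp _ (Metric.ball_mem_nhds p (half_pos hε))
  -- Properness: the closed ball is compact and misses `F`, so eventually no point of `E k` is much
  -- closer to `x` than `F` is.
  have h2 := h.eventually_disjoint (isCompact_closedBall x (Metric.infDist x F - ε / 2)) (by
    rw [disjoint_left]
    intro z hz hzF
    have := Metric.infDist_le_dist_of_mem (x := x) hzF
    rw [Metric.mem_closedBall, dist_comm] at hz
    linarith)
  obtain ⟨N, hN⟩ := eventually_atTop.1 (h1.and h2)
  refine ⟨N, fun k hk => ?_⟩
  obtain ⟨⟨z, hz, hzp⟩, h2⟩ := hN k hk.le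
  have hu : Metric.infDist x (E k) < Metric.infDist x F + ε / 2 := by
    have := Metric.infDist_le_dist_of_mem (x := x) hz
    have := dist_triangle_right x z p
    rw [Metric.mem_ball] at hzp
    linarith
  have hl : Metric.infDist x F - ε / 2 ≤ Metric.infDist x (E k) := by
    refine (Metric.le_infDist ⟨z, hz⟩).2 fun y hy => ?_
    by_contra hlt
    have : y ∈ E k ∩ Metric.closedBall x (Metric.infDist x F - ε / 2) :=
      ⟨hy, by rw [Metric.mem_closedBall, dist_comm]; linarith⟩
    rw [h2] at this
    exact this
  rw [Real.dist_eq, abs_lt]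
  constructor <;> linarith

/-- Kuratowski limits do not commute with intersections in general. Here a ball meeting both `A k`
and `C k` is connected and covered by these two closed sets, hence it meets their intersection. -/
theorem inter {X : Type*} [NormedAddCommGroup X] [NormedSpace ℝ X] {A C : ℕ → Set X} {A' C' : Set X}
    (hA : KuratowskiLim A A') (hC : KuratowskiLim C C') (hAc : ∀ k, IsClosed (A k))
    (hCc : ∀ k, IsClosed (C k)) (hU : ∀ k, A k ∪ C k = univ) :
    KuratowskiLim (fun k => A k ∩ C k) (A' ∩ C') := by
  refine ⟨fun x hx U hU' => ?_, fun x hx => ?_⟩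
  · obtain ⟨ε, hε, hεU⟩ := Metric.mem_nhds_iff.1 hU'
    filter_upwards [hA.1 x hx.1 _ (Metric.ball_mem_nhds x hε),
      hC.1 x hx.2 _ (Metric.ball_mem_nhds x hε)] with k h1 h2
    have := isPreconnected_closed_iff.1 (convex_ball x ε).isPreconnected (A k) (C k) (hAc k) (hCc k)
      (by rw [hU k]; exact subset_univ _) (by rwa [inter_comm]) (by rwa [inter_comm])
    obtain ⟨z, hz, hz'⟩ := this
    exact ⟨z, hz', hεU hz⟩
  · rw [mem_inter_iff, not_and_or] at hx
    rcases hx with hx | hx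
    · obtain ⟨U, hU, hev⟩ := hA.2 x hx
      refine ⟨U, hU, ?_⟩
      filter_upwards [hev] with k hk
      exact subset_empty_iff.1 (hk ▸ inter_subset_inter_left _ inter_subset_left)
    · obtain ⟨U, hU, hev⟩ := hC.2 x hx
      refine ⟨U, hU, ?_⟩
      filter_upwards [hev] with k hk
      exact subset_empty_iff.1 (hk ▸ inter_subset_inter_left _ inter_subset_right)

end KuratowskiLim

theorem tendstoLocallyUniformly_of_lipschitzWith {X : Type*} [PseudoMetricSpace X]
    {f : ℕ → X → ℝ} {g : X → ℝ} {K : NNReal} (hf : ∀ k, LipschitzWith K (f k))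
    (hg : LipschitzWith K g) (h : ∀ x, Tendsto (fun k => f k x) atTop (𝓝 (g x))) :
    TendstoLocallyUniformly f g atTop := by
  rw [Metric.tendstoLocallyUniformly_iff]
  intro ε hε x
  have hK : (0 : ℝ) < K + 1 := by positivity
  refine ⟨Metric.ball x (ε / (3 * (K + 1))), Metric.ball_mem_nhds _ (by positivity), ?_⟩
  filter_upwards [(Metric.tendsto_nhds.1 (h x)) (ε / 3) (by positivity)] with k hk y hy
  have h1 := (hf k).dist_le_mul x y
  have h2 := hg.dist_le_mul y x
  rw [Metric.mem_ball, lt_div_iff₀ (by positivity)] at hy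
  have h3 : (K : ℝ) * dist y x < ε / 3 := by nlinarith [dist_nonneg (x := y) (y := x)]
  rw [dist_comm x y] at h1
  have h4 := dist_triangle4_right (g y) (f k y) (g x) (f k x)
  have h5 := dist_triangle (g y) (g x) (f k y)
  have h6 := dist_triangle (g x) (f k x) (f k y)
  rw [dist_comm] at hk
  linarith

/-! ### The signed distance -/

/-- At each point one of the two distances vanishes. Both sets on the right are closed, so each term
can follow a Kuratowski limit. -/
theorem sdist_eq (S : Set Plane) (x : Plane) :
    sdist S x = Metric.infDist x (closure S) - Metric.infDist x (interior S)ᶜ := by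
  rw [← closure_compl, Metric.infDist_closure, Metric.infDist_closure, sdist]
  split_ifs with h
  · rw [Metric.infDist_zero_of_mem h, zero_sub]
  · rw [Metric.infDist_zero_of_mem (show x ∈ Sᶜ from h), sub_zero]

theorem lipschitzWith_sdist (S : Set Plane) : LipschitzWith 2 (sdist S) := by
  have h := (Metric.lipschitz_infDist_pt (closure S)).sub
    (Metric.lipschitz_infDist_pt (interior S)ᶜ)
  rw [one_add_one_eq_two] at h
  rw [show sdist S = _ from funext (sdist_eq S)]
  exact h

theorem tendstoLocallyUniformly_sdist {S : ℕ → Set Plane} {T : Set Plane}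
    (h1 : KuratowskiLim (fun k => closure (S k)) (closure T))
    (h2 : KuratowskiLim (fun k => (interior (S k))ᶜ) (interior T)ᶜ)
    (hT : T.Nonempty) (hT' : (interior T)ᶜ.Nonempty) :
    TendstoLocallyUniformly (fun k => sdist (S k)) (sdist T) atTop := by
  refine tendstoLocallyUniformly_of_lipschitzWith (fun k => lipschitzWith_sdist _)
    (lipschitzWith_sdist _) fun x => ?_
  simp only [sdist_eq]
  exact (h1.tendsto_infDist hT.closure x).sub (h2.tendsto_infDist hT' x)

/-! ### Length of connected sets -/

/-- The distance to `x` is `1`-Lipschitz and, by connectedness, takes all values in `[0, r)` on `E ∩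
ball x r`. -/
theorem le_hausdorffMeasure_inter_ball {X : Type*} [MetricSpace X] [MeasurableSpace X]
    [BorelSpace X] {E : Set X} (hE : IsPreconnected E) {x y : X} (hx : x ∈ E) (hy : y ∈ E) {r : ℝ}
    (hr : r ≤ dist x y) :
    ENNReal.ofReal r ≤ Measure.hausdorffMeasure 1 (E ∩ Metric.ball x r) := by
  have hsub : Ico 0 r ⊆ (fun z => dist x z) '' (E ∩ Metric.ball x r) := by
    intro t ht
    have hc := hE.intermediate_value hx hy (f := fun z => dist x z) (by fun_prop)
    rw [dist_self] at hc
    obtain ⟨z, hz, hzt⟩ := hc ⟨ht.1, ht.2.le.trans hr⟩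
    refine ⟨z, ⟨hz, ?_⟩, hzt⟩
    rw [Metric.mem_ball, dist_comm]
    exact hzt.trans_lt ht.2
  have h1 := (LipschitzWith.dist_right x).hausdorffMeasure_image_le zero_le_one
    (E ∩ Metric.ball x r)
  rw [hausdorffMeasure_real, ENNReal.coe_one, ENNReal.one_rpow, one_mul] at h1
  refine le_trans ?_ h1
  calc ENNReal.ofReal r = volume (Ico 0 r) := by rw [Real.volume_Ico, sub_zero]
    _ ≤ _ := measure_mono hsub

/-- The balls of radius `δ / 2` about the points are disjoint. By `hdeg`, `E` reaches outside each
of them, so each contains length at least `δ / 2` of `E`. -/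
theorem card_mul_le_hausdorffMeasure {X ι : Type*} [MetricSpace X] [MeasurableSpace X]
    [BorelSpace X] {E : Set X} (hE : IsPreconnected E) (s : Finset ι) (z : ι → X) {δ : ℝ}
    (hz : ∀ i ∈ s, z i ∈ E) (hsep : ∀ i ∈ s, ∀ j ∈ s, i ≠ j → δ < dist (z i) (z j))
    (hdeg : ∀ i ∈ s, ∃ y ∈ E, δ / 2 ≤ dist (z i) y) :
    s.card * ENNReal.ofReal (δ / 2) ≤ Measure.hausdorffMeasure 1 E := by
  let μ : Measure X := (Measure.hausdorffMeasure 1).restrict E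
  have h1 : ∀ i ∈ s, ENNReal.ofReal (δ / 2) ≤ μ (Metric.ball (z i) (δ / 2)) := by
    intro i hi
    obtain ⟨y, hy, hd⟩ := hdeg i hi
    rw [Measure.restrict_apply Metric.isOpen_ball.measurableSet, inter_comm]
    exact le_hausdorffMeasure_inter_ball hE (hz i hi) hy hd
  calc s.card * ENNReal.ofReal (δ / 2) = ∑ _i ∈ s, ENNReal.ofReal (δ / 2) := by
        rw [Finset.sum_const, nsmul_eq_mul]
    _ ≤ ∑ i ∈ s, μ (Metric.ball (z i) (δ / 2)) := Finset.sum_le_sum h1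
    _ = μ (⋃ i ∈ s, Metric.ball (z i) (δ / 2)) := by
        rw [measure_biUnion_finset _ fun i _ => Metric.isOpen_ball.measurableSet]
        intro i hi j hj hij
        apply Metric.ball_disjoint_ball
        linarith [hsep i hi j hj hij]
    _ ≤ μ univ := measure_mono (subset_univ _)
    _ = _ := by rw [Measure.restrict_apply_univ]

theorem card_mul_le_toReal {n : ℕ} {δ : ℝ} {M : ℝ≥0∞} (hδ : 0 < δ) (hM : M ≠ ⊤)
    (h : n * ENNReal.ofReal δ ≤ M) : n * δ ≤ M.toReal := by
  have := ENNReal.toReal_mono hM h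
  rwa [ENNReal.toReal_mul, ENNReal.toReal_natCast, ENNReal.toReal_ofReal hδ.le] at this

/-- If the `δ`-separated finite subsets of `E` have at most `N` elements, then one of them is a
`δ`-net. -/
theorem exists_separated_net {X : Type*} [MetricSpace X] {E : Set X} {δ : ℝ} (hδ : 0 ≤ δ) {N : ℕ}
    (hN : ∀ s : Finset X, ↑s ⊆ E → (∀ a ∈ s, ∀ b ∈ s, a ≠ b → δ < dist a b) → s.card ≤ N) :
    ∃ s : Finset X, ↑s ⊆ E ∧ s.card ≤ N ∧ ∀ z ∈ E, ∃ a ∈ s, dist z a ≤ δ := by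
  classical
  let P : ℕ → Prop := fun n => ∃ s : Finset X, s.card = n ∧ ↑s ⊆ E ∧
    ∀ a ∈ s, ∀ b ∈ s, a ≠ b → δ < dist a b
  have hP0 : P 0 := ⟨∅, by simp⟩
  have hb : ∀ n, P n → n ≤ N := by
    rintro n ⟨s, rfl, h1, h2⟩
    exact hN s h1 h2
  obtain ⟨s, hs, hsE, hsep⟩ := Nat.findGreatest_spec (P := P) (Nat.zero_le N) hP0
  refine ⟨s, hsE, hN s hsE hsep, fun z hz => ?_⟩
  by_contra! hcon
  have hzs : z ∉ s := fun hzs => by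
    have h := hcon z hzs
    rw [dist_self] at h
    linarith
  have hP : P (s.card + 1) := by
    refine ⟨insert z s, Finset.card_insert_of_notMem hzs, ?_, ?_⟩
    · rw [Finset.coe_insert]
      exact insert_subset hz hsE
    · intro a ha b hb hab
      rw [Finset.mem_insert] at ha hb
      rcases ha with rfl | ha <;> rcases hb with rfl | hb
      · exact absurd rfl hab
      · exact hcon b hb
      · rw [dist_comm]; exact hcon a ha
      · exact hsep a ha b hb hab
  have := Nat.le_findGreatest (P := P) (hb _ hP) hP
  omega

/-! ### Arcs in continua of finite length -/

theorem exists_lipschitz_of_approx {X : Type*} [MetricSpace X] {E : Set X} (hE : IsCompact E)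
    {x y : X} {C : ℝ}
    (h : ∀ ε > 0, ∃ f : ℝ → X, f 0 = x ∧ f 1 = y ∧ (∀ t, f t ∈ E) ∧
      ∀ s ∈ Icc (0 : ℝ) 1, ∀ t ∈ Icc (0 : ℝ) 1, dist (f s) (f t) ≤ C * |s - t| + ε) :
    ∃ f : ℝ → X, f 0 = x ∧ f 1 = y ∧ (∀ t, f t ∈ E) ∧
      ∀ s ∈ Icc (0 : ℝ) 1, ∀ t ∈ Icc (0 : ℝ) 1, dist (f s) (f t) ≤ C * |s - t| := by
  choose f h0 h1 hfE hf using fun n : ℕ => h (1 / ((n : ℝ) + 1)) (by positivity)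
  -- The approximating maps need not be continuous. Compactness of `E` gives pointwise limits along
  -- an ultrafilter, and the error `ε` disappears in the limit.
  let u : Ultrafilter ℕ := hyperfilter ℕ
  have hu : (u : Filter ℕ) ≤ atTop := Nat.hyperfilter_le_atTop
  have hlim : ∀ t, ∃ z ∈ E, Tendsto (fun n => f n t) u (𝓝 z) := fun t => by
    obtain ⟨z, hz, hle⟩ := hE.ultrafilter_le_nhds (u.map fun n => f n t)
      (le_principal_iff.2 (univ_mem' (fun n => hfE n t) : (fun n => f n t) ⁻¹' E ∈ (u : Filter ℕ)))
    exact ⟨z, hz, hle⟩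
  choose g hgE hg using hlim
  refine ⟨g, ?_, ?_, hgE, fun s hs t ht => ?_⟩
  · exact tendsto_nhds_unique (hg 0) (by simp only [h0]; exact tendsto_const_nhds)
  · exact tendsto_nhds_unique (hg 1) (by simp only [h1]; exact tendsto_const_nhds)
  · have hε : Tendsto (fun n : ℕ => C * |s - t| + 1 / ((n : ℝ) + 1)) u (𝓝 (C * |s - t| + 0)) :=
      tendsto_const_nhds.add (tendsto_one_div_add_atTop_nhds_zero_nat.mono_left hu)
    rw [add_zero] at hε
    exact le_of_tendsto_of_tendsto' ((hg s).dist (hg t)) hε fun n => hf n s hs t ht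

theorem dist_le_of_dist_succ_le {X : Type*} [MetricSpace X] {g : ℕ → X} {c : ℝ}
    (h : ∀ i, dist (g i) (g (i + 1)) ≤ c) (i j : ℕ) :
    dist (g i) (g j) ≤ c * |(i : ℝ) - j| := by
  have key : ∀ i k : ℕ, dist (g i) (g (i + k)) ≤ c * k := by
    intro i k
    induction k with
    | zero => simp
    | succ k ih =>
      have := dist_triangle (g i) (g (i + k)) (g (i + (k + 1)))
      have := h (i + k)
      push_cast
      rw [← add_assoc] at *
      linarith
  rcases le_total i j with hij | hij
  · obtain ⟨k, rfl⟩ := Nat.exists_eq_add_of_le hij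
    have := key i k
    push_cast
    rwa [sub_add_cancel_left, abs_neg, Nat.abs_cast]
  · obtain ⟨k, rfl⟩ := Nat.exists_eq_add_of_le hij
    have := key j k
    push_cast
    rwa [add_sub_cancel_left, Nat.abs_cast, dist_comm]

/-- The points of a finite `δ`-net of a connected set are joined by chains with steps at most
`2δ`. -/
theorem exists_chain {X : Type*} [MetricSpace X] {E : Set X} (hE : IsPreconnected E) {δ : ℝ}
    (hδ : 0 ≤ δ) (s : Finset X) (hs : ↑s ⊆ E) (hnet : ∀ z ∈ E, ∃ a ∈ s, dist z a ≤ δ)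
    {a b : X} (ha : a ∈ s) (hb : b ∈ s) :
    ∃ (n : ℕ) (g : ℕ → X), n < s.card ∧ g 0 = a ∧ g n = b ∧ (∀ i, g i ∈ E) ∧
      ∀ i, dist (g i) (g (i + 1)) ≤ 2 * δ := by
  classical
  let G : SimpleGraph s :=
    { Adj := fun a b => a ≠ b ∧ dist a.1 b.1 ≤ 2 * δ
      symm := ⟨fun a b h => ⟨h.1.symm, dist_comm a.1 b.1 ▸ h.2⟩⟩
      loopless := ⟨fun a h => h.1 rfl⟩ }
  have hreach : G.Reachable ⟨a, ha⟩ ⟨b, hb⟩ := by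
    by_contra hcon
    -- The balls centred at reachable and at unreachable net points form two closed sets covering
    -- `E`. Connectedness makes them meet, and a common point yields an edge between the two
    -- classes.
    let R : Set s := {c | G.Reachable ⟨a, ha⟩ c}
    have hcl : ∀ T : Set s, IsClosed (⋃ c ∈ T, Metric.closedBall c.1 δ) := fun T =>
      T.toFinite.isClosed_biUnion fun _ _ => Metric.isClosed_closedBall
    have hcov : E ⊆ (⋃ c ∈ R, Metric.closedBall c.1 δ) ∪ ⋃ c ∈ Rᶜ, Metric.closedBall c.1 δ := by
      intro z hz
      obtain ⟨c, hc, hzc⟩ := hnet z hz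
      by_cases hcR : (⟨c, hc⟩ : s) ∈ R
      · exact Or.inl (mem_biUnion hcR hzc)
      · exact Or.inr (mem_biUnion (show (⟨c, hc⟩ : s) ∈ Rᶜ from hcR) hzc)
    obtain ⟨z, _, hz1, hz2⟩ := isPreconnected_closed_iff.1 hE _ _ (hcl R) (hcl Rᶜ) hcov
      ⟨a, hs ha, mem_biUnion (show (⟨a, ha⟩ : s) ∈ R from SimpleGraph.Reachable.refl _)
        (Metric.mem_closedBall_self hδ)⟩
      ⟨b, hs hb, mem_biUnion (show (⟨b, hb⟩ : s) ∈ Rᶜ from hcon)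
        (Metric.mem_closedBall_self hδ)⟩
    simp only [mem_iUnion, exists_prop] at hz1 hz2
    obtain ⟨c, hc, hzc⟩ := hz1
    obtain ⟨d, hd, hzd⟩ := hz2
    refine hd (SimpleGraph.Reachable.trans hc (SimpleGraph.Adj.reachable ⟨?_, ?_⟩))
    · rintro rfl
      exact hd hc
    · rw [Metric.mem_closedBall] at hzc hzd
      have := dist_triangle_left c.1 d.1 z
      linarith
  -- A path visits each vertex at most once, which bounds its length by the size of the net.
  obtain ⟨w, hw⟩ := hreach.exists_isPath
  refine ⟨w.length, fun i => (w.getVert i).1, ?_, by simp, by simp, fun i => hs (w.getVert i).2,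
    fun i => ?_⟩
  · have := hw.length_lt
    rwa [Fintype.card_coe] at this
  · beta_reduce
    by_cases hi : i < w.length
    · exact (w.adj_getVert_succ hi).2
    · push Not at hi
      rw [w.getVert_of_length_le hi, w.getVert_of_length_le (hi.trans (Nat.le_succ i)), dist_self]
      positivity

theorem abs_floor_sub_floor_le {a b : ℝ} (ha : 0 ≤ a) (hb : 0 ≤ b) :
    |(⌊a⌋₊ : ℝ) - ⌊b⌋₊| ≤ |a - b| + 1 := by
  have h1 := Nat.floor_le ha
  have h2 := Nat.floor_le hb
  have h3 := Nat.lt_floor_add_one a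
  have h4 := Nat.lt_floor_add_one b
  have h5 := abs_le.1 (le_refl |a - b|)
  rw [abs_le]
  constructor <;> linarith

/-- A `δ`-net of at most `2M / δ` points is joined by a chain with steps at most `2δ`. Run through
at uniform speed, the chain has Lipschitz constant `4M` up to an error of order `δ`, uniformly in
`δ`. -/
theorem exists_lipschitz_path {X : Type*} [MetricSpace X] [MeasurableSpace X] [BorelSpace X]
    {E : Set X} (hE : IsCompact E) (hc : IsPreconnected E)
    (hfin : Measure.hausdorffMeasure 1 E ≠ ⊤) {x y : X} (hx : x ∈ E) (hy : y ∈ E) (hxy : x ≠ y) :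
    ∃ C : ℝ, 0 ≤ C ∧ ∃ f : ℝ → X, f 0 = x ∧ f 1 = y ∧ (∀ t, f t ∈ E) ∧
      ∀ s ∈ Icc (0 : ℝ) 1, ∀ t ∈ Icc (0 : ℝ) 1, dist (f s) (f t) ≤ C * |s - t| := by
  set M := (Measure.hausdorffMeasure 1 E).toReal with hM
  have hM0 : 0 ≤ M := ENNReal.toReal_nonneg
  refine ⟨4 * M, by positivity, exists_lipschitz_of_approx hE fun ε hε => ?_⟩
  have hd : 0 < dist x y := dist_pos.2 hxy
  -- The error `4δ` is `δ` at each endpoint plus `2δ` from rounding. The bound `δ ≤ dist x y` puts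
  -- `x` or `y` at distance at least `δ / 2` from any point.
  obtain ⟨δ, hδ, hδε, hδd⟩ : ∃ δ > 0, 4 * δ ≤ ε ∧ δ ≤ dist x y :=
    ⟨min (ε / 4) (dist x y), by positivity, by linarith [min_le_left (ε / 4) (dist x y)],
      min_le_right _ _⟩
  have hcard : ∀ s : Finset X, ↑s ⊆ E → (∀ a ∈ s, ∀ b ∈ s, a ≠ b → δ < dist a b) →
      (s.card : ℝ) * (δ / 2) ≤ M := by
    intro s hsE hsep
    refine card_mul_le_toReal (half_pos hδ) hfin
      (card_mul_le_hausdorffMeasure hc s id (fun i hi => hsE hi) hsep fun i hi => ?_)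
    by_contra! hcon
    have h1 := hcon x hx
    have h2 := hcon y hy
    have h3 := dist_triangle_left x y i
    simp only [id] at h1 h2
    linarith
  obtain ⟨s, hsE, hsN, hnet⟩ := exists_separated_net hδ.le (N := ⌊M / (δ / 2)⌋₊) fun s h1 h2 =>
    Nat.le_floor ((le_div_iff₀ (half_pos hδ)).2 (hcard s h1 h2))
  obtain ⟨a, ha, hxa⟩ := hnet x hx
  obtain ⟨b, hb, hyb⟩ := hnet y hy
  obtain ⟨n, g, hn, hg0, hgn, hgE, hg⟩ := exists_chain hc hδ.le s hsE hnet ha hb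
  have hnM : (n : ℝ) * δ ≤ 2 * M := by
    have h1 : (n : ℝ) ≤ M / (δ / 2) :=
      (Nat.cast_le.2 (hn.le.trans hsN)).trans (Nat.floor_le (by positivity))
    rw [le_div_iff₀ (half_pos hδ)] at h1
    linarith
  let G : ℝ → X := fun t => g ⌊t * n⌋₊
  let f : ℝ → X := fun t => if t = 0 then x else if t = 1 then y else G t
  have hfG : ∀ t, dist (f t) (G t) ≤ δ := by
    intro t
    simp only [f]
    split_ifs with h0 h1
    · simpa [G, h0, hg0] using hxa
    · simpa [G, h1, hgn] using hyb
    · rw [dist_self]; exact hδ.le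
  refine ⟨f, by simp [f], by simp [f], fun t => ?_, fun s hs t ht => ?_⟩
  · simp only [f]
    split_ifs
    exacts [hx, hy, hgE _]
  · have h1 := dist_triangle4 (f s) (G s) (G t) (f t)
    have h2 := hfG s
    have h3 := hfG t
    rw [dist_comm] at h3
    have h4 : dist (G s) (G t) ≤ 2 * δ * (|s - t| * n + 1) := by
      refine (dist_le_of_dist_succ_le hg _ _).trans (mul_le_mul_of_nonneg_left ?_ (by positivity))
      refine (abs_floor_sub_floor_le (mul_nonneg hs.1 n.cast_nonneg)
        (mul_nonneg ht.1 n.cast_nonneg)).trans_eq ?_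
      rw [← sub_mul, abs_mul, Nat.abs_cast]
    have h5 : 2 * δ * (|s - t| * n) ≤ 4 * M * |s - t| := by
      nlinarith [mul_le_mul_of_nonneg_left hnM (abs_nonneg (s - t))]
    linarith

/-- A path with least Lipschitz constant on `[0, 1]` is injective: a loop could be cut out and the
rest reparametrized with a smaller constant. -/
theorem exists_arc {X : Type*} [MetricSpace X] [MeasurableSpace X] [BorelSpace X]
    {E : Set X} (hE : IsCompact E) (hc : IsPreconnected E)
    (hfin : Measure.hausdorffMeasure 1 E ≠ ⊤) {x y : X} (hx : x ∈ E) (hy : y ∈ E) (hxy : x ≠ y) :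
    ∃ f : ℝ → X, f 0 = x ∧ f 1 = y ∧ (∀ t, f t ∈ E) ∧ ContinuousOn f (Icc 0 1) ∧
      InjOn f (Icc 0 1) := by
  let P : Set ℝ := {C | 0 ≤ C ∧ ∃ f : ℝ → X, f 0 = x ∧ f 1 = y ∧ (∀ t, f t ∈ E) ∧
      ∀ s ∈ Icc (0 : ℝ) 1, ∀ t ∈ Icc (0 : ℝ) 1, dist (f s) (f t) ≤ C * |s - t|}
  have hPne : P.Nonempty := exists_lipschitz_path hE hc hfin hx hy hxy
  have hPbdd : BddBelow P := ⟨0, fun C hC => hC.1⟩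
  set C := sInf P with hC
  have hC0 : 0 ≤ C := le_csInf hPne fun _ h => h.1
  obtain ⟨f, h0, h1, hfE, hf⟩ : ∃ f : ℝ → X, f 0 = x ∧ f 1 = y ∧ (∀ t, f t ∈ E) ∧
      ∀ s ∈ Icc (0 : ℝ) 1, ∀ t ∈ Icc (0 : ℝ) 1, dist (f s) (f t) ≤ C * |s - t| := by
    refine exists_lipschitz_of_approx hE fun ε hε => ?_
    obtain ⟨C', ⟨_, f, h0, h1, hfE, hf⟩, hlt⟩ := exists_lt_of_csInf_lt hPne
      (lt_add_of_pos_right C hε)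
    refine ⟨f, h0, h1, hfE, fun s hs t ht => (hf s hs t ht).trans ?_⟩
    have h2 : |s - t| ≤ 1 := abs_le.2 ⟨by linarith [hs.1, ht.2], by linarith [hs.2, ht.1]⟩
    nlinarith [abs_nonneg (s - t)]
  have hCpos : 0 < C := by
    have := hf 0 (by simp) 1 (by simp)
    rw [h0, h1] at this
    have hd := dist_pos.2 hxy
    norm_num at this
    linarith
  refine ⟨f, h0, h1, hfE, ?_, ?_⟩
  · refine (LipschitzOnWith.of_dist_le_mul (K := ⟨C, hC0⟩) fun s hs t ht => ?_).continuousOn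
    exact hf s hs t ht
  · have key : ∀ s ∈ Icc (0 : ℝ) 1, ∀ t ∈ Icc (0 : ℝ) 1, s < t → f s ≠ f t := by
      intro s hs t ht hst heq
      let q : ℝ := 1 - (t - s)
      have hq0 : 0 ≤ q := by simp only [q]; linarith [hs.1, ht.2]
      -- The map `φ` runs through `[0, 1]` at speed `q` and jumps over the loop between `s` and `t`.
      let φ : ℝ → ℝ := fun τ => if τ * q ≤ s then τ * q else τ * q + (t - s)
      have hφ : ∀ τ ∈ Icc (0 : ℝ) 1, φ τ ∈ Icc (0 : ℝ) 1 := by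
        intro τ hτ
        have h1 : 0 ≤ τ * q := mul_nonneg hτ.1 hq0
        have h2 : τ * q ≤ q := mul_le_of_le_one_left hq0 hτ.2
        simp only [φ]
        split_ifs with h
        · exact ⟨h1, h.trans hs.2⟩
        · exact ⟨by linarith, by simp only [q] at h2 ⊢; linarith⟩
      have hle : ∀ a ∈ Icc (0 : ℝ) 1, ∀ b ∈ Icc (0 : ℝ) 1, a ≤ b →
          dist (f (φ a)) (f (φ b)) ≤ C * q * (b - a) := by
        intro a ha b hb hab
        have hab' : a * q ≤ b * q := mul_le_mul_of_nonneg_right hab hq0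
        have hA := hφ a ha
        have hB := hφ b hb
        by_cases h1 : b * q ≤ s
        · have h2 := hf _ hA _ hB
          simp only [φ, if_pos h1, if_pos (hab'.trans h1)] at h2 ⊢
          rw [abs_sub_comm, abs_of_nonneg (by linarith)] at h2
          linarith
        · by_cases h3 : a * q ≤ s
          · have h4 := hf _ hA _ hs
            have h5 := hf _ ht _ hB
            have h6 := dist_triangle (f (φ a)) (f s) (f (φ b))
            simp only [φ, if_neg h1, if_pos h3] at h4 h5 h6 ⊢
            rw [abs_sub_comm, abs_of_nonneg (by linarith)] at h4 h5
            rw [← heq] at h5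
            linarith
          · have h2 := hf _ hA _ hB
            simp only [φ, if_neg h1, if_neg h3] at h2 ⊢
            rw [abs_sub_comm, abs_of_nonneg (by linarith)] at h2
            linarith
      have hmem : C * q ∈ P := by
        refine ⟨mul_nonneg hC0 hq0, fun τ => f (φ τ), ?_, ?_, fun τ => hfE _, fun a ha b hb => ?_⟩
        · simp only [φ, zero_mul, if_pos hs.1, h0]
        · simp only [φ, one_mul]
          split_ifs with h
          -- The jump is never made only when the loop ends at time `1`; then `f s` is already `y`.
          · have ht1 : t = 1 := le_antisymm ht.2 (by simp only [q] at h; linarith)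
            rw [← h1, ← ht1, ← heq]
            congr 1
            simp only [q]; linarith
          · rw [← h1]
            congr 1
            simp only [q]; ring
        · rcases le_total a b with hab | hab
          · rw [abs_sub_comm, abs_of_nonneg (sub_nonneg.2 hab)]
            exact hle a ha b hb hab
          · rw [dist_comm, abs_of_nonneg (sub_nonneg.2 hab)]
            exact hle b hb a ha hab
      have := csInf_le hPbdd hmem
      rw [← hC] at this
      have hqlt : q < 1 := by simp only [q]; linarith
      nlinarith
    intro s hs t ht heq
    rcases lt_trichotomy s t with h | h | h
    · exact absurd heq (key s hs t ht h)
    · exact h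
    · exact absurd heq.symm (key t ht s hs h)

/-! ### One-dimensional densities -/

theorem ediam_closedBall_le {X : Type*} [PseudoMetricSpace X] (x : X) (r : ℝ) :
    Metric.ediam (Metric.closedBall x r) ≤ ENNReal.ofReal (2 * r) := by
  refine Metric.ediam_le fun y hy z hz => ?_
  rw [edist_dist]
  apply ENNReal.ofReal_le_ofReal
  rw [Metric.mem_closedBall] at hy hz
  linarith [dist_triangle_right y z x]

/-- The upper density of a set of finite length is at most `1` at almost all of its points. -/
theorem ae_eventually_hausdorffMeasure_le {E : Set Plane} (hE : H1 E ≠ ⊤) {t : ℝ} (ht : 1 < t) :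
    ∀ᵐ x ∂(H1.restrict E), ∀ᶠ r in 𝓝[>] (0 : ℝ),
      H1.restrict E (Metric.closedBall x r) ≤ ENNReal.ofReal (t * (2 * r)) := by
  set μ := H1.restrict E with hμ
  have : IsFiniteMeasure μ := ⟨by rw [hμ, Measure.restrict_apply_univ]; exact hE.lt_top⟩
  have ht0 : 0 < t := zero_lt_one.trans ht
  let f : Plane → Set ℝ := fun x => {r | ENNReal.ofReal (t * (2 * r)) < μ (Metric.closedBall x r)}
  let s : Set Plane := {x | ¬ ∀ᶠ r in 𝓝[>] (0 : ℝ),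
      μ (Metric.closedBall x r) ≤ ENNReal.ofReal (t * (2 * r))}
  change μ s = 0
  have hf : ∀ x ∈ s, ∀ δ > 0, (f x ∩ Ioo 0 δ).Nonempty := by
    intro x hx δ hδ
    obtain ⟨r, h1, h2⟩ := ((not_eventually.1 hx).and_eventually (Ioo_mem_nhdsGT hδ)).exists
    exact ⟨r, not_le.1 h1, h2⟩
  -- Disjoint small balls in `U`, each with diameter below `1 / t` times its measure, cover almost
  -- all of `s`, so the length of `s` is at most `μ U / t`. Letting `U` shrink to `s` forces `μ s =
  -- 0`, because `t > 1`.
  have key : ∀ U : Set Plane, IsOpen U → s ⊆ U → ENNReal.ofReal t * μ s ≤ μ U := by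
    intro U hU hsU
    have hRex : ∀ x, ∃ R > 0, x ∈ s → Metric.closedBall x R ⊆ U := by
      intro x
      by_cases hx : x ∈ s
      · obtain ⟨R, hR, h⟩ := Metric.nhds_basis_closedBall.mem_iff.1 (hU.mem_nhds (hsU hx))
        exact ⟨R, hR, fun _ => h⟩
      · exact ⟨1, one_pos, fun h => absurd h hx⟩
    choose R hR hRU using hRex
    choose T r hTc hTs hr hcov hdisj using fun n : ℕ =>
      Besicovitch.exists_disjoint_closedBall_covering_ae μ f s hf
        (fun x => min (R x) (1 / ((n : ℝ) + 1))) fun x _ => lt_min (hR x) (by positivity)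
    -- Each family misses only a null set; outside the union `N` of these sets all families cover,
    -- as the Hausdorff measure estimate requires.
    let N : Set Plane := ⋃ n, s \ ⋃ x ∈ T n, Metric.closedBall x (r n x)
    have hN : μ N = 0 := measure_iUnion_null hcov
    have hcount : ∀ n, Countable (T n) := fun n => (hTc n).to_subtype
    have hsum : ∀ n, ∑' x : T n, Metric.ediam (Metric.closedBall x.1 (r n x)) ^ (1 : ℝ) ≤
        (ENNReal.ofReal t)⁻¹ * μ U := by
      intro n
      calc ∑' x : T n, Metric.ediam (Metric.closedBall x.1 (r n x)) ^ (1 : ℝ)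
          ≤ ∑' x : T n, (ENNReal.ofReal t)⁻¹ * μ (Metric.closedBall x.1 (r n x)) := by
            refine ENNReal.tsum_le_tsum fun x => ?_
            rw [ENNReal.rpow_one]
            refine (ediam_closedBall_le _ _).trans ?_
            rw [← ENNReal.div_eq_inv_mul, ENNReal.le_div_iff_mul_le
              (Or.inl (ENNReal.ofReal_pos.2 ht0).ne') (Or.inl ENNReal.ofReal_ne_top), mul_comm,
              ← ENNReal.ofReal_mul ht0.le]
            exact ((hr n x x.2).1 : _ < _).le
        _ = (ENNReal.ofReal t)⁻¹ * μ (⋃ x ∈ T n, Metric.closedBall x (r n x)) := by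
            rw [ENNReal.tsum_mul_left, measure_biUnion (hTc n) (hdisj n)
              fun x _ => Metric.isClosed_closedBall.measurableSet]
        _ ≤ (ENNReal.ofReal t)⁻¹ * μ U := by
            gcongr
            refine iUnion₂_subset fun x hx => ?_
            refine Subset.trans (Metric.closedBall_subset_closedBall ?_) (hRU x (hTs n hx))
            exact (hr n x hx).2.2.le.trans (min_le_left _ _)
    have hH : H1 (s \ N) ≤ (ENNReal.ofReal t)⁻¹ * μ U := by
      have h0 : Tendsto (fun n : ℕ => ENNReal.ofReal (2 * (1 / ((n : ℝ) + 1)))) atTop (𝓝 0) := by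
        have := (tendsto_one_div_add_atTop_nhds_zero_nat (𝕜 := ℝ)).const_mul 2
        rw [mul_zero] at this
        simpa using ENNReal.tendsto_ofReal this
      refine (Measure.hausdorffMeasure_le_liminf_tsum 1 (s \ N) _ h0
        (fun n (x : T n) => Metric.closedBall x.1 (r n x)) ?_ ?_).trans ?_
      · refine Eventually.of_forall fun n x => (ediam_closedBall_le _ _).trans ?_
        apply ENNReal.ofReal_le_ofReal
        have := (hr n x x.2).2.2.le.trans (min_le_right _ _)
        linarith
      · refine Eventually.of_forall fun n x hx => ?_
        by_contra hcon
        refine hx.2 (mem_iUnion.2 ⟨n, hx.1, fun h => hcon ?_⟩)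
        obtain ⟨y, hy, hxy⟩ := mem_iUnion₂.1 h
        exact mem_iUnion.2 ⟨⟨y, hy⟩, hxy⟩
      · exact liminf_le_of_frequently_le' (Frequently.of_forall hsum)
    have hsN : μ s ≤ H1 (s \ N) := by
      calc μ s ≤ μ (s \ N ∪ N) := measure_mono (by rw [sdiff_union_self]; exact subset_union_left)
        _ ≤ μ (s \ N) + μ N := measure_union_le _ _
        _ = μ (s \ N) := by rw [hN, add_zero]
        _ ≤ H1 (s \ N) := Measure.restrict_apply_le _ _
    calc ENNReal.ofReal t * μ s ≤ ENNReal.ofReal t * ((ENNReal.ofReal t)⁻¹ * μ U) := by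
          gcongr
          exact hsN.trans hH
      _ = μ U := by
          rw [← mul_assoc, ENNReal.mul_inv_cancel (ENNReal.ofReal_pos.2 ht0).ne'
            ENNReal.ofReal_ne_top, one_mul]
  have hle : ENNReal.ofReal t * μ s ≤ μ s := by
    refine ENNReal.le_of_forall_pos_le_add fun ε hε _ => ?_
    obtain ⟨U, hsU, hU, hμU⟩ := s.exists_isOpen_le_add μ (ENNReal.coe_pos.2 hε).ne'
    exact (key U hU hsU).trans hμU
  by_contra h0
  have h1 := ENNReal.mul_lt_mul_left h0 (measure_ne_top μ s)
    (ENNReal.one_lt_ofReal.2 ht)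
  rw [one_mul] at h1
  exact absurd hle (not_le.2 h1)

instance : NullSingletonClass H1 := Measure.nullSingletonClass_hausdorff Plane one_pos

/-- `x` lies in the interior of an arc contained in `E`. -/
def IsArcInterior {X : Type*} [TopologicalSpace X] (E : Set X) (x : X) : Prop :=
  ∃ f : ℝ → X, ContinuousOn f (Icc 0 1) ∧ InjOn f (Icc 0 1) ∧ MapsTo f (Icc 0 1) E ∧
    ∃ t ∈ Ioo (0 : ℝ) 1, f t = x

/-- The two halves of the arc each contribute length `r`, and by injectivity they share only the
point `x`. -/
theorem IsArcInterior.eventually_le {E : Set Plane} {x : Plane} (h : IsArcInterior E x) :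
    ∀ᶠ r in 𝓝[>] (0 : ℝ), ENNReal.ofReal (2 * r) ≤ H1 (E ∩ Metric.ball x r) := by
  obtain ⟨f, hf, hinj, hmaps, t, ht, rfl⟩ := h
  have ht' : t ∈ Icc (0 : ℝ) 1 := Ioo_subset_Icc_self ht
  have h0 : f t ≠ f 0 := fun h => ht.1.ne' (hinj ht' (by simp) h)
  have h1 : f t ≠ f 1 := fun h => ht.2.ne (hinj ht' (by simp) h)
  have hs1 : Icc 0 t ⊆ Icc (0 : ℝ) 1 := Icc_subset_Icc_right ht.2.le
  have hs2 : Icc t 1 ⊆ Icc (0 : ℝ) 1 := Icc_subset_Icc_left ht.1.le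
  have hc1 : IsPreconnected (f '' Icc 0 t) := isPreconnected_Icc.image f (hf.mono hs1)
  have hc2 : IsPreconnected (f '' Icc t 1) := isPreconnected_Icc.image f (hf.mono hs2)
  have hm2 : MeasurableSet (f '' Icc t 1) :=
    (isCompact_Icc.image_of_continuousOn (hf.mono hs2)).isClosed.measurableSet
  have hpos : 0 < min (dist (f t) (f 0)) (dist (f t) (f 1)) :=
    lt_min (dist_pos.2 h0) (dist_pos.2 h1)
  filter_upwards [Ioo_mem_nhdsGT hpos] with r hr
  have e1 := le_hausdorffMeasure_inter_ball hc1 (mem_image_of_mem f (right_mem_Icc.2 ht.1.le))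
    (mem_image_of_mem f (left_mem_Icc.2 ht.1.le)) (hr.2.le.trans (min_le_left _ _))
  have e2 := le_hausdorffMeasure_inter_ball hc2 (mem_image_of_mem f (left_mem_Icc.2 ht.2.le))
    (mem_image_of_mem f (right_mem_Icc.2 ht.2.le)) (hr.2.le.trans (min_le_right _ _))
  have hnull : H1 {f t} = 0 := measure_singleton _
  have hcap : f '' Icc 0 t ∩ f '' Icc t 1 ⊆ {f t} := by
    rintro _ ⟨⟨a, ha, rfl⟩, ⟨b, hb, hab⟩⟩
    have := hinj (hs2 hb) (hs1 ha) hab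
    rw [mem_singleton_iff, le_antisymm ha.2 (this ▸ hb.1)]
  calc ENNReal.ofReal (2 * r) = ENNReal.ofReal r + ENNReal.ofReal r := by
        rw [← ENNReal.ofReal_add hr.1.le hr.1.le, two_mul]
    _ ≤ H1 (f '' Icc 0 t ∩ Metric.ball (f t) r) + H1 (f '' Icc t 1 ∩ Metric.ball (f t) r) :=
        add_le_add e1 e2
    _ = H1 (f '' Icc 0 t ∩ Metric.ball (f t) r ∪ f '' Icc t 1 ∩ Metric.ball (f t) r) := by
        refine (measure_union₀ (hm2.inter Metric.isOpen_ball.measurableSet).nullMeasurableSet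
          (measure_mono_null ?_ hnull)).symm
        exact (inter_subset_inter inter_subset_left inter_subset_left).trans hcap
    _ ≤ H1 (E ∩ Metric.ball (f t) r) := by
        refine measure_mono (union_subset ?_ ?_) <;> refine inter_subset_inter_left _ ?_
        · exact (hmaps.mono_left hs1).image_subset
        · exact (hmaps.mono_left hs2).image_subset

/-- An arc from a density point `x` of the bad set `B` to another point of `E` consists, apart from
its endpoints, of good points. It contributes length `r` to the ball of radius `r`, too much to be
compatible with density one of `B`. -/
theorem ae_isArcInterior {E : Set Plane} (hE : IsCompact E) (hc : IsPreconnected E)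
    (hfin : H1 E ≠ ⊤) : ∀ᵐ x ∂(H1.restrict E), IsArcInterior E x := by
  by_cases hnt : E.Subsingleton
  · have : H1.restrict E = 0 := Measure.restrict_eq_zero.2 (hnt.measure_zero _)
    rw [this]
    simp
  rw [not_subsingleton_iff] at hnt
  set μ := H1.restrict E with hμ
  have : IsFiniteMeasure μ := ⟨by rw [hμ, Measure.restrict_apply_univ]; exact hfin.lt_top⟩
  let B : Set Plane := {x | ¬ IsArcInterior E x}
  change μ B = 0
  have hmem : ∀ᵐ x ∂μ, x ∈ E := ae_restrict_mem hE.isClosed.measurableSet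
  have hup := ae_eventually_hausdorffMeasure_le hfin (t := 3 / 2) (by norm_num)
  -- No measurability of `B` is available; the Besicovitch density theorem holds at almost every
  -- point of `μ.restrict B` for an arbitrary set.
  rw [← Measure.restrict_apply_self]
  suffices h : ∀ᵐ x ∂(μ.restrict B), x ∉ B by
    rw [ae_iff] at h
    convert h using 2
    ext a
    simp
  filter_upwards [Besicovitch.ae_tendsto_measure_inter_div μ B, ae_restrict_of_ae hmem,
    ae_restrict_of_ae hup] with x hlim hxE hup hxB
  obtain ⟨y, hy, hyx⟩ := hnt.exists_ne x
  obtain ⟨f, h0, h1, hfE, hf, hinj⟩ := exists_arc hE hc hfin hxE hy hyx.symm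
  let A : Set Plane := f '' Icc 0 1 \ {x, y}
  have hcomp : IsCompact (f '' Icc 0 1) := isCompact_Icc.image_of_continuousOn hf
  have hA : MeasurableSet A := hcomp.isClosed.measurableSet.diff
    ((Set.toFinite _).isClosed.measurableSet)
  have hAB : ∀ z ∈ A, z ∉ B := by
    rintro z ⟨⟨t, ht, rfl⟩, hz⟩ hzB
    rw [mem_insert_iff, mem_singleton_iff, not_or] at hz
    refine hzB ⟨f, hf, hinj, fun s _ => hfE s, t, ⟨?_, ?_⟩, rfl⟩
    · exact lt_of_le_of_ne ht.1 (fun h => hz.1 (h ▸ h0))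
    · exact lt_of_le_of_ne ht.2 (fun h => hz.2 (h ▸ h1))
  have hpos : 0 < dist x y := dist_pos.2 hyx.symm
  -- If `m` is the measure of the ball, then `r + 3m/4 ≤ m` and `m ≤ 3r`, which is impossible.
  have h34 : ENNReal.ofReal (3 / 4) < 1 := by
    rw [ENNReal.ofReal_lt_one]; norm_num
  have hev : ∀ᶠ r in 𝓝[>] (0 : ℝ), r ∈ Ioo 0 (dist x y) := Ioo_mem_nhdsGT hpos
  obtain ⟨r, hr, hlim, hup⟩ := (hev.and
    ((hlim.eventually_const_lt h34).and hup)).exists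
  have hAr : ENNReal.ofReal r ≤ μ (Metric.closedBall x r ∩ A) := by
    have h2 := le_hausdorffMeasure_inter_ball (isPreconnected_Icc.image f hf)
      ⟨0, by simp, h0⟩ ⟨1, by simp, h1⟩ hr.2.le
    have hsub : f '' Icc 0 1 ∩ Metric.ball x r ⊆ (Metric.closedBall x r ∩ A ∩ E) ∪ {x, y} := by
      rintro z ⟨hz, hzr⟩
      by_cases hzxy : z ∈ ({x, y} : Set Plane)
      · exact Or.inr hzxy
      · refine Or.inl ⟨⟨Metric.ball_subset_closedBall hzr, hz, hzxy⟩, ?_⟩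
        obtain ⟨t, _, rfl⟩ := hz
        exact hfE t
    have hnull : H1 ({x, y} : Set Plane) = 0 := (Set.toFinite _).measure_zero _
    rw [hμ, Measure.restrict_apply (Metric.isClosed_closedBall.measurableSet.inter hA)]
    calc ENNReal.ofReal r ≤ _ := h2
      _ ≤ _ := measure_mono hsub
      _ ≤ _ := measure_union_le _ _
      _ = _ := by rw [hnull, add_zero]
  have hsum : ENNReal.ofReal r + μ (B ∩ Metric.closedBall x r) ≤ μ (Metric.closedBall x r) := by
    rw [← measure_inter_add_sdiff (Metric.closedBall x r) hA]
    exact add_le_add hAr (measure_mono fun z hz => ⟨hz.2, fun hzA => hAB z hzA hz.1⟩)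
  have hB := ENNReal.mul_le_of_le_div hlim.le
  have hm : μ (Metric.closedBall x r) ≠ ⊤ := measure_ne_top _ _
  have hmB : μ (B ∩ Metric.closedBall x r) ≠ ⊤ := measure_ne_top _ _
  rw [← ENNReal.ofReal_toReal hm] at hup hsum hB
  rw [← ENNReal.ofReal_toReal hmB] at hsum hB
  have hr0 := hr.1
  rw [← ENNReal.ofReal_add hr0.le ENNReal.toReal_nonneg,
    ENNReal.ofReal_le_ofReal_iff ENNReal.toReal_nonneg] at hsum
  rw [← ENNReal.ofReal_mul (by norm_num), ENNReal.ofReal_le_ofReal_iff ENNReal.toReal_nonneg] at hB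
  rw [ENNReal.ofReal_le_ofReal_iff (by positivity)] at hup
  linarith

/-- A closed subset of finite length of a finite union of continua is rectifiable. -/
theorem isH1Rectifiable_of_subset_iUnion {ι : Type*} [Finite ι] {G : ι → Set Plane}
    (hG : ∀ i, IsCompact (G i)) (hc : ∀ i, IsPreconnected (G i)) (hfin : ∀ i, H1 (G i) ≠ ⊤)
    {K : Set Plane} (hK : K ⊆ ⋃ i, G i) :
    IsH1Rectifiable K := by
  have := Fintype.ofFinite ι
  set E := ⋃ i, G i with hEdef
  have hE : H1 E ≠ ⊤ := by
    refine (lt_of_le_of_lt (measure_iUnion_fintype_le _ _) ?_).ne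
    exact ENNReal.sum_lt_top.2 fun i _ => (hfin i).lt_top
  have hEc : IsClosed E := isClosed_iUnion_of_finite fun i => (hG i).isClosed
  set μ := H1.restrict E with hμ
  have : IsFiniteMeasure μ := ⟨by rw [hμ, Measure.restrict_apply_univ]; exact hE.lt_top⟩
  have hKμ : μ.restrict K = H1.restrict K := Measure.restrict_restrict_of_subset hK
  have hup : ∀ᵐ x ∂μ, ∀ n : ℕ, ∀ᶠ r in 𝓝[>] (0 : ℝ),
      μ (Metric.closedBall x r) ≤ ENNReal.ofReal ((1 + 1 / ((n : ℝ) + 1)) * (2 * r)) :=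
    ae_all_iff.2 fun n => ae_eventually_hausdorffMeasure_le hE
      (lt_add_of_pos_right _ (by positivity))
  have hlow : ∀ᵐ x ∂μ, ∀ᶠ r in 𝓝[>] (0 : ℝ),
      ENNReal.ofReal (2 * r) ≤ μ (Metric.closedBall x r) := by
    rw [hμ, hEdef, ae_restrict_iUnion_iff]
    intro i
    filter_upwards [ae_isArcInterior (hG i) (hc i) (hfin i)] with x hx
    filter_upwards [hx.eventually_le] with r hr
    refine hr.trans ?_
    rw [Measure.restrict_apply Metric.isClosed_closedBall.measurableSet, inter_comm]
    exact measure_mono (inter_subset_inter Metric.ball_subset_closedBall (subset_iUnion G i))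
  refine ⟨lt_of_le_of_lt (measure_mono hK) hE.lt_top, ?_⟩
  rw [← hKμ]
  -- Almost every point of `K` is a density point of `K` in `E`, so the lower bound for `E` passes
  -- to `K`.
  filter_upwards [Besicovitch.ae_tendsto_measure_inter_div μ K, ae_restrict_of_ae hup,
    ae_restrict_of_ae hlow] with x hlim hup hlow
  have hKH : ∀ r, μ (K ∩ Metric.closedBall x r) = H1 (K ∩ Metric.closedBall x r) := fun r => by
    rw [hμ, Measure.restrict_eq_self _ (inter_subset_left.trans hK)]
  have hpos : ∀ᶠ r in 𝓝[>] (0 : ℝ), 0 < r := self_mem_nhdsWithin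
  refine tendsto_order.2 ⟨fun a ha => ?_, fun a ha => ?_⟩
  · have hatop : a ≠ ⊤ := ne_top_of_lt ha
    set b := a.toReal with hb
    have hb0 : 0 ≤ b := ENNReal.toReal_nonneg
    have hb1 : b < 1 := by
      have := (ENNReal.toReal_lt_toReal hatop ENNReal.one_ne_top).2 ha
      rwa [ENNReal.toReal_one] at this
    -- One factor `c` is lost to the density of `K`, another in fitting a closed ball into an open
    -- one; `c * c > b` because `c² - b = ((1 - b) / 2)²`.
    set c : ℝ := (1 + b) / 2 with hcdef
    have hc0 : 0 < c := by positivity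
    have hc1 : c < 1 := by rw [hcdef]; linarith
    have hKlow : ∀ᶠ r in 𝓝[>] (0 : ℝ),
        ENNReal.ofReal (c * (2 * r)) ≤ H1 (K ∩ Metric.closedBall x r) := by
      filter_upwards [hlim.eventually_const_lt (ENNReal.ofReal_lt_one.2 hc1), hlow] with r h1 h2
      rw [← hKH, ENNReal.ofReal_mul hc0.le]
      exact (mul_le_mul_right h2 _).trans (ENNReal.mul_le_of_le_div h1.le)
    have htend : Tendsto (fun r => c * r) (𝓝[>] (0 : ℝ)) (𝓝[>] 0) := by
      refine tendsto_nhdsWithin_iff.2 ⟨?_, hpos.mono fun r hr => mul_pos hc0 hr⟩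
      have : Tendsto (fun r => c * r) (𝓝 (0 : ℝ)) (𝓝 (c * 0)) := tendsto_id.const_mul c
      rw [mul_zero] at this
      exact this.mono_left nhdsWithin_le_nhds
    filter_upwards [htend.eventually hKlow, hpos] with r hr hr0
    have h1 : ENNReal.ofReal (c * (2 * (c * r))) ≤ H1 (K ∩ Metric.ball x r) :=
      hr.trans (measure_mono (inter_subset_inter_right _
        (Metric.closedBall_subset_ball (by nlinarith))))
    rw [ENNReal.lt_div_iff_mul_lt (Or.inl (ENNReal.ofReal_pos.2 (by positivity)).ne')
      (Or.inl ENNReal.ofReal_ne_top)]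
    refine lt_of_lt_of_le ?_ h1
    rw [← ENNReal.ofReal_toReal hatop, ← ENNReal.ofReal_mul hb0,
      ENNReal.ofReal_lt_ofReal_iff (by positivity)]
    have : b < c * c := by rw [hcdef]; nlinarith [mul_pos (sub_pos.2 hb1) (sub_pos.2 hb1)]
    nlinarith
  · obtain ⟨n, hn⟩ : ∃ n : ℕ, ENNReal.ofReal (1 + 1 / ((n : ℝ) + 1)) < a := by
      have h1 : Tendsto (fun n : ℕ => ENNReal.ofReal (1 + 1 / ((n : ℝ) + 1))) atTop (𝓝 1) := by
        have := (tendsto_one_div_add_atTop_nhds_zero_nat (𝕜 := ℝ)).const_add 1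
        rw [add_zero] at this
        simpa using ENNReal.tendsto_ofReal this
      exact (h1.eventually_lt_const ha).exists
    filter_upwards [hup n, hpos] with r hr hr0
    refine lt_of_le_of_lt ?_ hn
    apply ENNReal.div_le_of_le_mul
    rw [← ENNReal.ofReal_mul (by positivity)]
    refine le_trans ?_ hr
    rw [hμ, Measure.restrict_apply Metric.isClosed_closedBall.measurableSet, inter_comm]
    exact measure_mono (inter_subset_inter Metric.ball_subset_closedBall hK)

/-! ### Limits of continua of bounded length -/

/-- Only finiteness is needed, so the sharp semicontinuity is avoided. Separated points of `F` move
to separated points of some `E k`, so `F` has `δ`-nets of at most `4M / δ` points, whose balls give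
length at most `8M`. -/
theorem KuratowskiLim.hausdorffMeasure_ne_top {X : Type*} [MetricSpace X] [MeasurableSpace X]
    [BorelSpace X] {E : ℕ → Set X} {F : Set X} (h : KuratowskiLim E F)
    (hc : ∀ k, IsPreconnected (E k)) {M : ℝ≥0∞} (hM : M ≠ ⊤)
    (hE : ∀ k, Measure.hausdorffMeasure 1 (E k) ≤ M) : Measure.hausdorffMeasure 1 F ≠ ⊤ := by
  by_cases hnt : F.Subsingleton
  · have := Measure.nullSingletonClass_hausdorff X one_pos
    have : Measure.hausdorffMeasure 1 F = 0 := hnt.measure_zero _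
    rw [this]
    exact ENNReal.zero_ne_top
  rw [not_subsingleton_iff] at hnt
  obtain ⟨p, hp, q, hq, hpq⟩ := hnt
  have hd : 0 < dist p q := dist_pos.2 hpq
  have hcard : ∀ δ > 0, δ ≤ dist p q → ∀ s : Finset X, ↑s ⊆ F →
      (∀ a ∈ s, ∀ b ∈ s, a ≠ b → δ < dist a b) → s.card * ENNReal.ofReal (δ / 4) ≤ M := by
    intro δ hδ hδd s hs hsep
    -- Moving points by less than `δ / 8` keeps mutual distances above `δ / 2`, and keeps the images
    -- of `p`, `q` far enough apart that one is at distance `δ / 4` from any given point.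
    have hev : ∀ a ∈ F, ∀ᶠ k in atTop, (E k ∩ Metric.ball a (δ / 8)).Nonempty := fun a ha =>
      h.1 a ha _ (Metric.ball_mem_nhds a (by positivity))
    obtain ⟨k, hk, ⟨p', hp', hpp⟩, ⟨q', hq', hqq⟩⟩ :=
      (((s.eventually_all).2 fun a ha => hev a (hs ha)).and ((hev p hp).and (hev q hq))).exists
    have hex : ∀ a, ∃ z, a ∈ s → z ∈ E k ∧ dist z a < δ / 8 := by
      intro a
      by_cases ha : a ∈ s
      · obtain ⟨z, hz, hza⟩ := hk a ha
        exact ⟨z, fun _ => ⟨hz, hza⟩⟩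
      · exact ⟨a, fun h => absurd h ha⟩
    choose z hz using hex
    have := card_mul_le_hausdorffMeasure (hc k) s z (δ := δ / 2) (fun i hi => (hz i hi).1) ?_ ?_
    · rw [div_div] at this
      norm_num at this
      exact this.trans (hE k)
    · intro a ha b hb hab
      have h1 := (hz a ha).2
      have h2 := (hz b hb).2
      have h3 := dist_triangle4_left (z a) (z b) a b
      have := hsep a ha b hb hab
      linarith
    · intro a ha
      by_contra! hcon
      have h1 := hcon p' hp'
      have h2 := hcon q' hq'
      have h3 := dist_triangle_left p' q' (z a)
      have h4 := dist_triangle4_left p' q' p q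
      rw [Metric.mem_ball] at hpp hqq
      linarith
  choose s hsF hsN hnet using fun n : ℕ => by
    have hδ : 0 < dist p q / ((n : ℝ) + 1) := by positivity
    exact exists_separated_net (E := F) hδ.le (N := ⌊M.toReal / (dist p q / ((n : ℝ) + 1) / 4)⌋₊)
      fun s h1 h2 => Nat.le_floor ((le_div_iff₀ (by positivity)).2
        (card_mul_le_toReal (by positivity) hM
          (hcard _ hδ (div_le_self hd.le (by linarith [n.cast_nonneg (α := ℝ)])) s h1 h2)))
  have h0 : Tendsto (fun n : ℕ => ENNReal.ofReal (2 * (dist p q / ((n : ℝ) + 1)))) atTop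
      (𝓝 0) := by
    have := (tendsto_one_div_add_atTop_nhds_zero_nat (𝕜 := ℝ)).const_mul (2 * dist p q)
    rw [mul_zero] at this
    have h2 := ENNReal.tendsto_ofReal this
    rw [ENNReal.ofReal_zero] at h2
    refine h2.congr fun n => ?_
    rw [mul_one_div, mul_div_assoc]
  refine (lt_of_le_of_lt (Measure.hausdorffMeasure_le_liminf_tsum 1 F _ h0
    (fun n (x : s n) => Metric.closedBall x.1 (dist p q / ((n : ℝ) + 1))) ?_ ?_)
    (lt_of_le_of_lt (b := ENNReal.ofReal (8 * M.toReal)) ?_ ENNReal.ofReal_lt_top)).ne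
  · exact Eventually.of_forall fun n x => ediam_closedBall_le _ _
  · refine Eventually.of_forall fun n x hx => ?_
    obtain ⟨a, ha, hxa⟩ := hnet n x hx
    exact mem_iUnion.2 ⟨⟨a, ha⟩, hxa⟩
  · refine liminf_le_of_frequently_le' (Frequently.of_forall fun n => ?_)
    set δ := dist p q / ((n : ℝ) + 1) with hδdef
    have hδ : 0 < δ := by positivity
    have hcardn : ((s n).card : ℝ) ≤ M.toReal / (δ / 4) :=
      (Nat.cast_le.2 (hsN n)).trans (Nat.floor_le (by positivity))
    calc ∑' x : s n, Metric.ediam (Metric.closedBall x.1 δ) ^ (1 : ℝ)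
        ≤ ∑' _x : s n, ENNReal.ofReal (2 * δ) := by
          refine ENNReal.tsum_le_tsum fun x => ?_
          rw [ENNReal.rpow_one]
          exact ediam_closedBall_le _ _
      _ = ENNReal.ofReal ((s n).card * (2 * δ)) := by
          rw [tsum_fintype, Finset.sum_const, nsmul_eq_mul, Finset.card_univ, Fintype.card_coe,
            ENNReal.ofReal_mul (Nat.cast_nonneg _), ENNReal.ofReal_natCast]
      _ ≤ _ := by
          apply ENNReal.ofReal_le_ofReal
          rw [le_div_iff₀ (by positivity)] at hcardn
          linarith

/-! ### The geometry of subgraphs -/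

theorem abs_coord_le_norm (p : Plane) (i : Fin 2) : |p i| ≤ ‖p‖ := by
  rw [← Real.norm_eq_abs]
  exact PiLp.norm_apply_le p i

theorem lipschitzWith_coord (i : Fin 2) : LipschitzWith 1 fun p : Plane => p i := by
  refine LipschitzWith.of_dist_le_mul fun p q => ?_
  rw [NNReal.coe_one, one_mul, Real.dist_eq, dist_eq_norm]
  exact abs_coord_le_norm (p - q) i

theorem continuous_coord (i : Fin 2) : Continuous fun p : Plane => p i :=
  (lipschitzWith_coord i).continuous

theorem dist_horizontal (s t c : ℝ) : dist (!₂[s, c] : Plane) !₂[t, c] = |s - t| := by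
  simp [EuclideanSpace.dist_eq, Real.dist_eq, Real.sqrt_sq_eq_abs]

theorem dist_vertical (s t c : ℝ) : dist (!₂[c, s] : Plane) !₂[c, t] = |s - t| := by
  simp [EuclideanSpace.dist_eq, Real.dist_eq, Real.sqrt_sq_eq_abs]

theorem eq_vec (p : Plane) : p = !₂[p 0, p 1] := by
  ext i
  fin_cases i <;> simp

theorem mem_closure_of_segment {s : Set Plane} {p q : Plane}
    (h : ∀ t ∈ Ioo (0 : ℝ) 1, p + t • (q - p) ∈ s) : p ∈ closure s := by
  have ht : Tendsto (fun t : ℝ => p + t • (q - p)) (𝓝[>] 0) (𝓝 p) := by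
    have : Continuous fun t : ℝ => p + t • (q - p) := by fun_prop
    have := this.tendsto 0
    rw [zero_smul, add_zero] at this
    exact this.mono_left nhdsWithin_le_nhds
  refine mem_closure_of_tendsto ht ?_
  filter_upwards [Ioo_mem_nhdsGT (zero_lt_one' ℝ)] with t ht
  exact h t ht

theorem closure_Omega {l L : ℝ} (hl : 0 < l) :
    closure (Omega l L) = {p | -l ≤ p 0 ∧ p 0 ≤ l ∧ -L ≤ p 1} := by
  refine Subset.antisymm (closure_minimal (fun p hp => ⟨hp.1.le, hp.2.1.le, hp.2.2.le⟩) ?_) ?_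
  · exact (isClosed_le continuous_const (continuous_coord 0)).inter
      ((isClosed_le (continuous_coord 0) continuous_const).inter
        (isClosed_le continuous_const (continuous_coord 1)))
  · rintro p ⟨h1, h2, h3⟩
    refine mem_closure_of_segment (q := !₂[0, -L + 1]) fun t ht => ?_
    have := ht.1
    have := ht.2
    refine ⟨?_, ?_, ?_⟩ <;> simp <;> nlinarith

theorem isOpen_Omega (l L : ℝ) : IsOpen (Omega l L) :=
  (isOpen_lt continuous_const (continuous_coord 0)).inter
    ((isOpen_lt (continuous_coord 0) continuous_const).inter
      (isOpen_lt continuous_const (continuous_coord 1)))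

theorem isClosed_subgraph {l : ℝ} {h : ℝ → ℝ} (hh : UpperSemicontinuousOn h (Icc (-l) l)) :
    IsClosed (subgraph l h) := by
  rw [← isOpen_compl_iff, isOpen_iff_mem_nhds]
  intro p hp
  by_cases hI : p 0 ∈ Icc (-l) l
  · have hlt : h (p 0) < p 1 := by
      by_contra! hle
      exact hp ⟨hI.1, hI.2, hle⟩
    obtain ⟨c, hc1, hc2⟩ := exists_between hlt
    have h1 := hh (p 0) hI c hc1
    rw [eventually_nhdsWithin_iff] at h1
    filter_upwards [(continuous_coord 0).continuousAt.eventually h1,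
      (continuous_coord 1).continuousAt.eventually (lt_mem_nhds hc2)] with q hq1 hq2 hq
    have := hq1 ⟨hq.1, hq.2.1⟩
    linarith [hq.2.2]
  · filter_upwards [(continuous_coord 0).continuousAt.eventually
      (isClosed_Icc.isOpen_compl.mem_nhds hI)] with q hq hq'
    exact hq ⟨hq'.1, hq'.2.1⟩

theorem interior_eq_empty_of_hausdorffMeasure_ne_top {K : Set Plane} (hK : H1 K ≠ ⊤) :
    interior K = ∅ := by
  by_contra hne
  have h1 := Real.dimH_of_nonempty_interior (nonempty_iff_ne_empty.2 hne)
  have h2 : dimH K ≤ (1 : NNReal) := dimH_le_of_hausdorffMeasure_ne_top (by simpa using hK)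
  rw [h1, finrank_euclideanSpace_fin] at h2
  norm_num at h2

theorem volume_eq_zero_of_hausdorffMeasure_ne_top {K : Set Plane} (hK : H1 K ≠ ⊤) :
    volume K = 0 := by
  have h2 : (Measure.hausdorffMeasure 2 : Measure Plane) K = 0 :=
    (Measure.hausdorffMeasure_zero_or_top (by norm_num : (1 : ℝ) < 2) K).resolve_right hK
  have hfr : ((Module.finrank ℝ Plane : ℕ) : ℝ) = 2 := by
    rw [finrank_euclideanSpace_fin]; norm_num
  have hH : Measure.IsAddHaarMeasure (Measure.hausdorffMeasure 2 : Measure Plane) := by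
    have := isAddHaarMeasure_hausdorffMeasure (E := Plane)
    rwa [hfr] at this
  exact Measure.absolutelyContinuous_isAddHaarMeasure volume (Measure.hausdorffMeasure 2) h2

/-- Near a point of `K` there are open pieces of `A`, which `K`, having empty interior, cannot fill.
-/
theorem closure_sdiff_of_subset {X : Type*} [TopologicalSpace X] {A K : Set X} (hA : IsClosed A)
    (hK : interior K = ∅) (hKA : K ⊆ closure (interior A)) : closure (A \ K) = A := by
  refine Subset.antisymm (closure_minimal sdiff_subset hA) fun x hx => ?_
  by_cases hxK : x ∈ K
  · rw [mem_closure_iff]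
    intro U hU hxU
    obtain ⟨y, hyU, hy⟩ := mem_closure_iff.1 (hKA hxK) U hU hxU
    by_contra hcon
    have hsub : U ∩ interior A ⊆ K := by
      intro z hz
      by_contra hzK
      exact hcon ⟨z, hz.1, interior_subset hz.2, hzK⟩
    have := interior_maximal hsub (hU.inter isOpen_interior) ⟨hyU, hy⟩
    rw [hK] at this
    exact this
  · exact subset_closure ⟨hx, hxK⟩

theorem interior_sdiff_of_isClosed {X : Type*} [TopologicalSpace X] {A K : Set X}
    (hK : IsClosed K) : interior (A \ K) = interior A \ K := by
  rw [sdiff_eq, interior_inter, hK.isOpen_compl.interior_eq, sdiff_eq]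

theorem closure_interior_subgraph_inter_subset {l L : ℝ} (hl : 0 < l) (hL : 0 < L) {h : ℝ → ℝ}
    (hh : ∀ x ∈ Icc (-l) l, 0 ≤ h x) :
    closure (interior (subgraph l h)) ∩ closure (Omega l L) ⊆
      closure (interior (subgraph l h ∩ closure (Omega l L))) := by
  rintro p ⟨hp, hpΩ⟩
  rw [closure_Omega hl] at hpΩ ⊢
  rcases hpΩ.2.2.lt_or_eq with hlt | heq
  · rw [mem_closure_iff] at hp ⊢
    intro U hU hpU
    have hV : IsOpen {q : Plane | -L < q 1} := isOpen_lt continuous_const (continuous_coord 1)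
    obtain ⟨w, ⟨hwU, hwL⟩, hw⟩ := hp (U ∩ {q | -L < q 1}) (hU.inter hV) ⟨hpU, hlt⟩
    refine ⟨w, hwU, interior_maximal ?_ (isOpen_interior.inter hV) ⟨hw, hwL⟩⟩
    rintro z ⟨hz, hzL⟩
    have hz := interior_subset hz
    exact ⟨hz, hz.1, hz.2.1, (show -L < z 1 from hzL).le⟩
  -- At the bottom edge the approximating points lie on a segment towards `(0, -L/2)`, within the
  -- strip `-L < y < 0` that every subgraph contains.
  · have hopen : IsOpen {q : Plane | -l < q 0 ∧ q 0 < l ∧ -L < q 1 ∧ q 1 < 0} :=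
      (isOpen_lt continuous_const (continuous_coord 0)).inter
        ((isOpen_lt (continuous_coord 0) continuous_const).inter
          ((isOpen_lt continuous_const (continuous_coord 1)).inter
            (isOpen_lt (continuous_coord 1) continuous_const)))
    refine closure_mono (interior_maximal ?_ hopen)
      (mem_closure_of_segment (q := !₂[0, -L / 2]) fun t ht => ?_)
    · rintro q ⟨h1, h2, h3, h4⟩
      exact ⟨⟨h1.le, h2.le, h4.le.trans (hh _ ⟨h1.le, h2.le⟩)⟩, h1.le, h2.le, h3.le⟩
    · have h1 := hpΩ.1
      have h2 := hpΩ.2.1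
      have := ht.1
      have := ht.2
      refine ⟨?_, ?_, ?_, ?_⟩ <;> simp <;> nlinarith

theorem IsHeightCrack.isClosed {l L : ℝ} {Λ : ℝ≥0∞} {h : ℝ → ℝ} {K : Set Plane}
    (H : IsHeightCrack l L Λ h K) : IsClosed (subgraph l h ∩ closure (Omega l L)) :=
  (isClosed_subgraph H.1.2.1).inter isClosed_closure

theorem crackedSubgraph_eq (l L : ℝ) (h : ℝ → ℝ) (K : Set Plane) :
    crackedSubgraph l L h K = (subgraph l h ∩ closure (Omega l L)) \ K := by
  rw [crackedSubgraph, sdiff_inter_right_comm]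

/-- The closure forgets the crack, so heights can be studied through closures alone; the crack is
visible only in the interior. -/
theorem IsHeightCrack.closure_eq {l L : ℝ} (hl : 0 < l) (hL : 0 < L) {Λ : ℝ≥0∞} {h : ℝ → ℝ}
    {K : Set Plane} (H : IsHeightCrack l L Λ h K) :
    closure (crackedSubgraph l L h K) = subgraph l h ∩ closure (Omega l L) := by
  rw [crackedSubgraph_eq]
  exact closure_sdiff_of_subset H.isClosed
    (interior_eq_empty_of_hausdorffMeasure_ne_top H.2.1.2.2.1.ne)
    ((subset_inter H.2.2 H.2.1.1).trans
      (closure_interior_subgraph_inter_subset hl hL fun x hx => (H.1.1 x hx).1))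

theorem IsHeightCrack.interior_eq {l L : ℝ} {Λ : ℝ≥0∞} {h : ℝ → ℝ} {K : Set Plane}
    (H : IsHeightCrack l L Λ h K) :
    interior (crackedSubgraph l L h K) =
      interior (subgraph l h ∩ closure (Omega l L)) \ K := by
  rw [crackedSubgraph_eq, interior_sdiff_of_isClosed H.2.1.2.1]

theorem IsHeightCrack.volume_eq {l L : ℝ} {Λ : ℝ≥0∞} {h : ℝ → ℝ} {K : Set Plane}
    (H : IsHeightCrack l L Λ h K) :
    volume (crackedSubgraph l L h K) = volume (subgraph l h ∩ closure (Omega l L)) := by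
  rw [crackedSubgraph_eq]
  exact measure_sdiff_null (volume_eq_zero_of_hausdorffMeasure_ne_top H.2.1.2.2.1.ne)

theorem mem_subgraph_inter {l L : ℝ} (hl : 0 < l) {h : ℝ → ℝ} {p : Plane} :
    p ∈ subgraph l h ∩ closure (Omega l L) ↔ p 0 ∈ Icc (-l) l ∧ p 1 ∈ Icc (-L) (h (p 0)) := by
  rw [closure_Omega hl]
  constructor
  · rintro ⟨h1, h2⟩
    exact ⟨⟨h1.1, h1.2.1⟩, h2.2.2, h1.2.2⟩
  · rintro ⟨h1, h2⟩
    exact ⟨⟨h1.1, h1.2, h2.2⟩, h1.1, h1.2, h2.1⟩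

/-! ### Length of boundaries and oscillation of heights -/

/-- Each horizontal line at a height in `Y` meets the frontier between `a` and `b`, and the
projection to the vertical axis is `1`-Lipschitz. The crossing point lies in the closed set `A`,
hence not over `a`. -/
theorem volume_le_hausdorffMeasure_frontier {A : Set Plane} (hA : IsClosed A) {a b : ℝ} {Y : Set ℝ}
    (ha : ∀ y ∈ Y, !₂[a, y] ∉ A) (hb : ∀ y ∈ Y, !₂[b, y] ∈ A) :
    volume Y ≤ H1 (frontier A ∩ {p | p 0 ∈ uIcc a b \ {a} ∧ p 1 ∈ Y}) := by
  have hsub : Y ⊆ (fun p : Plane => p 1) ''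
      (frontier A ∩ {p | p 0 ∈ uIcc a b \ {a} ∧ p 1 ∈ Y}) := by
    intro y hy
    let f : ℝ → Plane := fun s => !₂[s, y]
    have hf : Continuous f := by
      refine (LipschitzWith.of_dist_le_mul (K := 1) fun s t => ?_).continuous
      rw [dist_horizontal, NNReal.coe_one, one_mul, Real.dist_eq]
    have hB : IsClosed (f ⁻¹' A) := hA.preimage hf
    obtain ⟨s, hs, hsB⟩ : (uIcc a b ∩ frontier (f ⁻¹' A)).Nonempty := by
      by_contra hemp
      have hint : ∀ s ∈ uIcc a b, s ∈ f ⁻¹' A → s ∈ interior (f ⁻¹' A) := by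
        intro s hs hsA
        by_contra hsi
        exact hemp ⟨s, hs, subset_closure hsA, hsi⟩
      obtain ⟨s, _, hsi, hsA⟩ := isPreconnected_uIcc (interior (f ⁻¹' A)) (f ⁻¹' A)ᶜ
        isOpen_interior hB.isOpen_compl (fun s hs => by
          by_cases hsA : s ∈ f ⁻¹' A
          exacts [Or.inl (hint s hs hsA), Or.inr hsA])
        ⟨b, right_mem_uIcc, hint b right_mem_uIcc (hb y hy)⟩ ⟨a, left_mem_uIcc, ha y hy⟩
      exact hsA (interior_subset hsi)
    have hsA : s ∈ f ⁻¹' A := hB.frontier_subset hsB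
    refine ⟨f s, ⟨hf.frontier_preimage_subset A hsB, ⟨?_, ?_⟩, ?_⟩, ?_⟩
    · simpa [f] using hs
    · rintro h
      have : s = a := by simpa [f] using h
      exact ha y hy (this ▸ hsA)
    · simpa [f] using hy
    · simp [f]
  calc volume Y ≤ volume ((fun p : Plane => p 1) ''
      (frontier A ∩ {p | p 0 ∈ uIcc a b \ {a} ∧ p 1 ∈ Y})) := measure_mono hsub
    _ ≤ _ := by
      have := (lipschitzWith_coord 1).hausdorffMeasure_image_le zero_le_one
        (frontier A ∩ {p | p 0 ∈ uIcc a b \ {a} ∧ p 1 ∈ Y})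
      rwa [hausdorffMeasure_real, ENNReal.coe_one, ENNReal.one_rpow, one_mul] at this

theorem sub_le_hausdorffMeasure_frontier {l L : ℝ} (hl : 0 < l) (hL : 0 < L) {h : ℝ → ℝ}
    (hA : IsClosed (subgraph l h ∩ closure (Omega l L))) {a b c : ℝ}
    (hb : b ∈ Icc (-l) l) (hc : h a ≤ c) (hc0 : 0 ≤ c) :
    ENNReal.ofReal (h b - c) ≤ H1 (frontier (subgraph l h ∩ closure (Omega l L)) ∩
      {p | p 0 ∈ uIcc a b \ {a} ∧ c < p 1}) := by
  have key := volume_le_hausdorffMeasure_frontier hA (a := a) (b := b) (Y := Ioc c (h b)) ?_ ?_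
  · rw [Real.volume_Ioc] at key
    exact key.trans (measure_mono (inter_subset_inter_right _ fun p hp => ⟨hp.1, hp.2.1⟩))
  · intro y hy hmem
    have := ((mem_subgraph_inter hl).1 hmem).2.2
    simp at this
    linarith [hy.1]
  · intro y hy
    refine (mem_subgraph_inter hl).2 ⟨by simpa using hb, ?_⟩
    simp only [Matrix.cons_val_one, Matrix.cons_val_fin_one, Matrix.cons_val_zero]
    exact ⟨by linarith [hy.1], hy.2⟩

/-- A rise from `a` to `b` is paid for by boundary over `(a, b]`, a fall by boundary over `[a, b)`.
These lengths are increments of `v` and `u`, so the oscillation of `h` is dominated by that of the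
monotone function `u + v`. -/
theorem boundedVariationOn_height {l L : ℝ} (hl : 0 < l) (hL : 0 < L) {h : ℝ → ℝ}
    (hh : ∀ x ∈ Icc (-l) l, 0 ≤ h x) (hA : IsClosed (subgraph l h ∩ closure (Omega l L)))
    (hfin : H1 (frontier (subgraph l h ∩ closure (Omega l L))) ≠ ⊤) :
    BoundedVariationOn h (Icc (-l) l) := by
  set B := frontier (subgraph l h ∩ closure (Omega l L)) with hB
  have hBfin : ∀ T : Set Plane, H1 (B ∩ T) ≠ ⊤ := fun T =>
    ne_top_of_le_ne_top hfin (measure_mono inter_subset_left)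
  let u : ℝ → ℝ := fun x => (H1 (B ∩ {p | p 0 < x})).toReal
  let v : ℝ → ℝ := fun x => (H1 (B ∩ {p | p 0 ≤ x})).toReal
  have hu : Monotone u := fun a b hab => ENNReal.toReal_mono (hBfin _)
    (measure_mono (inter_subset_inter_right _ fun p (hp : p 0 < a) => hp.trans_le hab))
  have hv : Monotone v := fun a b hab => ENNReal.toReal_mono (hBfin _)
    (measure_mono (inter_subset_inter_right _ fun p (hp : p 0 ≤ a) => hp.trans hab))
  have hsplit : ∀ T₁ T₂ T₃ : Set Plane, MeasurableSet T₂ → Disjoint T₁ T₂ → T₁ ⊆ T₃ → T₂ ⊆ T₃ →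
      (H1 (B ∩ T₁)).toReal + (H1 (B ∩ T₂)).toReal ≤ (H1 (B ∩ T₃)).toReal := by
    intro T₁ T₂ T₃ hm hd h1 h2
    rw [← ENNReal.toReal_add (hBfin _) (hBfin _), ← measure_union
      (hd.mono inter_subset_right inter_subset_right) (isClosed_frontier.measurableSet.inter hm)]
    exact ENNReal.toReal_mono (hBfin _) (measure_mono
      (union_subset (inter_subset_inter_right _ h1) (inter_subset_inter_right _ h2)))
  have hm0 : Measurable fun p : Plane => p 0 := (continuous_coord 0).measurable
  have hinc : ∀ a ∈ Icc (-l) l, ∀ b ∈ Icc (-l) l, a ≤ b → h b - h a ≤ v b - v a := by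
    intro a ha b hb hab
    have h1 := sub_le_hausdorffMeasure_frontier hl hL hA hb le_rfl (hh a ha)
    have h2 := (ENNReal.ofReal_le_iff_le_toReal (hBfin _)).1 h1
    have h3 := hsplit {p | p 0 ≤ a} {p | p 0 ∈ Ioc a b} {p | p 0 ≤ b} (hm0 measurableSet_Ioc)
      (disjoint_left.2 fun p (h : p 0 ≤ a) h' => absurd h (not_le.2 h'.1))
      (fun p (h : p 0 ≤ a) => h.trans hab) (fun p h => h.2)
    have h4 : (H1 (B ∩ {p | p 0 ∈ uIcc a b \ {a} ∧ h a < p 1})).toReal ≤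
        (H1 (B ∩ {p | p 0 ∈ Ioc a b})).toReal := by
      refine ENNReal.toReal_mono (hBfin _) (measure_mono (inter_subset_inter_right _ ?_))
      rintro p ⟨⟨h5, h6⟩, _⟩
      rw [uIcc_of_le hab] at h5
      exact ⟨lt_of_le_of_ne h5.1 (Ne.symm h6), h5.2⟩
    simp only [v]
    linarith
  have hdec : ∀ a ∈ Icc (-l) l, ∀ b ∈ Icc (-l) l, a ≤ b → h a - h b ≤ u b - u a := by
    intro a ha b hb hab
    have h1 := sub_le_hausdorffMeasure_frontier hl hL hA ha le_rfl (hh b hb)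
    have h2 := (ENNReal.ofReal_le_iff_le_toReal (hBfin _)).1 h1
    have h3 := hsplit {p | p 0 < a} {p | p 0 ∈ Ico a b} {p | p 0 < b} (hm0 measurableSet_Ico)
      (disjoint_left.2 fun p (h : p 0 < a) h' => absurd h (not_lt.2 h'.1))
      (fun p (h : p 0 < a) => h.trans_le hab) (fun p h => h.2)
    have h4 : (H1 (B ∩ {p | p 0 ∈ uIcc b a \ {b} ∧ h b < p 1})).toReal ≤
        (H1 (B ∩ {p | p 0 ∈ Ico a b})).toReal := by
      refine ENNReal.toReal_mono (hBfin _) (measure_mono (inter_subset_inter_right _ ?_))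
      rintro p ⟨⟨h5, h6⟩, _⟩
      rw [uIcc_of_ge hab] at h5
      exact ⟨h5.1, lt_of_le_of_ne h5.2 h6⟩
    simp only [u]
    linarith
  let g : ℝ → ℝ := fun x => u x + v x
  have hle : eVariationOn h (Icc (-l) l) ≤ eVariationOn g (Icc (-l) l) := by
    have hpt : ∀ a ∈ Icc (-l) l, ∀ b ∈ Icc (-l) l, a ≤ b →
        edist (h b) (h a) ≤ edist (g b) (g a) := by
      intro a ha b hb hab
      rw [edist_dist, edist_dist, Real.dist_eq, Real.dist_eq]
      apply ENNReal.ofReal_le_ofReal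
      have h1 := hinc a ha b hb hab
      have h2 := hdec a ha b hb hab
      have h3 := hu hab
      have h4 := hv hab
      rw [abs_of_nonneg (a := g b - g a) (by simp only [g]; linarith), abs_le]
      simp only [g]
      constructor <;> linarith
    refine iSup_le fun q => ?_
    refine le_trans (Finset.sum_le_sum fun i _ => ?_) (le_iSup (fun q : ℕ × {w : ℕ → ℝ //
      Monotone w ∧ ∀ i, w i ∈ Icc (-l) l} => ∑ i ∈ Finset.range q.1,
        edist (g (q.2.1 (i + 1))) (g (q.2.1 i))) q)
    exact hpt _ (q.2.2.2 i) _ (q.2.2.2 (i + 1)) (q.2.2.1 (Nat.le_succ i))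
  have hg : BoundedVariationOn g (Icc (-l) l) := by
    have hmono : MonotoneOn g (Icc (-l) l) := (hu.add hv).monotoneOn _
    have hll : -l ≤ l := by linarith
    have := hmono.eVariationOn_eq (left_mem_Icc.2 hll) (right_mem_Icc.2 hll)
    rw [inter_self] at this
    exact ne_top_of_le_ne_top ENNReal.ofReal_ne_top this.le
  exact ne_top_of_le_ne_top hg hle

theorem volume_box (l c : ℝ) :
    volume {p : Plane | -l < p 0 ∧ p 0 < l ∧ 0 < p 1 ∧ p 1 < c} =
      ENNReal.ofReal (2 * l) * ENNReal.ofReal c := by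
  have h := (PiLp.volume_preserving_ofLp (Fin 2)).measure_preimage
    (s := Set.pi univ fun i : Fin 2 => Ioo ((![-l, 0] : Fin 2 → ℝ) i) ((![l, c] : Fin 2 → ℝ) i))
    (MeasurableSet.univ_pi fun i => measurableSet_Ioo).nullMeasurableSet
  rw [Real.volume_pi_Ioo, Fin.prod_univ_two] at h
  simp only [Matrix.cons_val_zero, Matrix.cons_val_one, Matrix.cons_val_fin_one, sub_zero,
    sub_neg_eq_add, ← two_mul] at h
  rw [← h]
  congr 1
  ext p
  simp [Set.mem_pi, Fin.forall_fin_two, and_assoc]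

/-- Either `h` drops to half of `h x` somewhere, which costs boundary length `h x / 2` inside `Ω`,
or it stays above that level, which costs area `l * h x`. -/
theorem height_le {l L : ℝ} (hl : 0 < l) (hL : 0 < L) {h : ℝ → ℝ}
    (hh : ∀ x ∈ Icc (-l) l, 0 ≤ h x) (hA : IsClosed (subgraph l h ∩ closure (Omega l L)))
    {M V : ℝ} (hM0 : 0 ≤ M) (hV0 : 0 ≤ V)
    (hM : H1 (Omega l L ∩ frontier (subgraph l h ∩ closure (Omega l L))) ≤ ENNReal.ofReal M)
    (hV : volume (subgraph l h ∩ closure (Omega l L)) ≤ ENNReal.ofReal V) {x : ℝ}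
    (hx : x ∈ Ioo (-l) l) : h x ≤ 2 * M + V / l := by
  have hx' := Ioo_subset_Icc_self hx
  have hVl : 0 ≤ V / l := by positivity
  by_cases hlow : ∃ a ∈ Ioo (-l) l, h a ≤ h x / 2
  · obtain ⟨a, ha, hax⟩ := hlow
    have h1 := sub_le_hausdorffMeasure_frontier hl hL hA hx' hax
      (by linarith [hh x hx'])
    have h2 : ENNReal.ofReal (h x - h x / 2) ≤ ENNReal.ofReal M := by
      refine h1.trans (le_trans (measure_mono ?_) hM)
      rintro p ⟨hp, ⟨hp0, _⟩, hp1⟩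
      have hI : p 0 ∈ Ioo (-l) l := by
        have : OrdConnected (Ioo (-l) l) := ordConnected_Ioo
        exact this.uIcc_subset ha hx hp0
      exact ⟨⟨hI.1, hI.2, by linarith [hh x hx']⟩, hp⟩
    rw [ENNReal.ofReal_le_ofReal_iff hM0] at h2
    linarith
  · push Not at hlow
    have h1 : volume {p : Plane | -l < p 0 ∧ p 0 < l ∧ 0 < p 1 ∧ p 1 < h x / 2} ≤
        ENNReal.ofReal V := by
      refine le_trans (measure_mono ?_) hV
      rintro p ⟨h1, h2, h3, h4⟩
      exact (mem_subgraph_inter hl).2 ⟨⟨h1.le, h2.le⟩, by linarith,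
        h4.le.trans (hlow _ ⟨h1, h2⟩).le⟩
    rw [volume_box, ← ENNReal.ofReal_mul (by positivity),
      ENNReal.ofReal_le_ofReal_iff hV0] at h1
    have : h x ≤ V / l := by
      rw [le_div_iff₀ hl]
      linarith
    linarith

/-- The points of `closure Ω` below the height `R`. -/
def lowerBox (l L R : ℝ) : Set Plane := {p | p 0 ∈ Icc (-l) l ∧ p 1 ∈ Icc (-L) R}

theorem isCompact_lowerBox (l L R : ℝ) : IsCompact (lowerBox l L R) := by
  have : lowerBox l L R = WithLp.ofLp ⁻¹' (Set.pi univ fun i : Fin 2 =>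
      Icc ((![-l, -L] : Fin 2 → ℝ) i) ((![l, R] : Fin 2 → ℝ) i)) := by
    ext p
    simp [lowerBox, Pi.le_def, Fin.forall_fin_two]
    tauto
  rw [this]
  exact (EuclideanSpace.equiv (Fin 2) ℝ).toHomeomorph.isCompact_preimage.2
    (isCompact_univ_pi fun i => isCompact_Icc)

theorem hausdorffMeasure_lowerBox_sdiff_ne_top (l L R : ℝ) :
    H1 (lowerBox l L R \ Omega l L) ≠ ⊤ := by
  have himg : ∀ (f : ℝ → Plane) (a b : ℝ), (∀ s t, dist (f s) (f t) = |s - t|) →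
      H1 (f '' Icc a b) ≠ ⊤ := by
    intro f a b hf
    have hL : LipschitzWith 1 f := LipschitzWith.of_dist_le_mul fun s t => by
      rw [hf, NNReal.coe_one, one_mul, Real.dist_eq]
    have := hL.hausdorffMeasure_image_le zero_le_one (Icc a b)
    rw [hausdorffMeasure_real, ENNReal.coe_one, ENNReal.one_rpow, one_mul, Real.volume_Icc] at this
    exact ne_top_of_le_ne_top ENNReal.ofReal_ne_top this
  have hsub : lowerBox l L R \ Omega l L ⊆ (fun t => !₂[t, -L]) '' Icc (-l) l ∪
      ((fun t => !₂[-l, t]) '' Icc (-L) R ∪ (fun t => !₂[l, t]) '' Icc (-L) R) := by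
    rintro p ⟨⟨h0, h1⟩, hp⟩
    by_cases e1 : p 1 = -L
    · exact Or.inl ⟨p 0, h0, by rw [← e1]; exact (eq_vec p).symm⟩
    by_cases e2 : p 0 = -l
    · exact Or.inr (Or.inl ⟨p 1, h1, by rw [← e2]; exact (eq_vec p).symm⟩)
    by_cases e3 : p 0 = l
    · refine Or.inr (Or.inr ⟨p 1, h1, ?_⟩)
      simp only
      rw [← e3]; exact (eq_vec p).symm
    exact absurd ⟨lt_of_le_of_ne h0.1 (Ne.symm e2), lt_of_le_of_ne h0.2 e3,
      lt_of_le_of_ne h1.1 (Ne.symm e1)⟩ hp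
  refine ne_top_of_le_ne_top ?_ (measure_mono hsub)
  exact measure_union_ne_top (himg _ _ _ fun s t => dist_horizontal s t _)
    (measure_union_ne_top (himg _ _ _ fun s t => dist_vertical s t _)
      (himg _ _ _ fun s t => dist_vertical s t _))

/-! ### Connected components -/

/-- Components may be repeated so that the number of pieces does not depend on the set; limits are
then taken piece by piece. -/
theorem exists_preconnected_cover {X : Type*} [TopologicalSpace X] {E : Set X} (hE : E.Nonempty)
    {n : ℕ} (hn : ENat.card (ConnectedComponents E) ≤ (n : ℕ∞)) :
    ∃ c : Fin n → Set X, (∀ j, IsPreconnected (c j)) ∧ (∀ j, (c j).Nonempty) ∧ E = ⋃ j, c j := by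
  have : Nonempty E := hE.to_subtype
  have : Finite (ConnectedComponents E) :=
    ENat.card_lt_top.1 (lt_of_le_of_lt hn (ENat.natCast_lt_top n))
  have := Fintype.ofFinite (ConnectedComponents E)
  have hcard : Fintype.card (ConnectedComponents E) ≤ Fintype.card (Fin n) := by
    rw [ENat.card_eq_coe_fintype_card] at hn
    rw [Fintype.card_fin]
    exact_mod_cast hn
  obtain ⟨e⟩ := Function.Embedding.nonempty_of_card_le hcard
  have hsurj := Function.invFun_surjective e.injective
  choose r hr using fun q : ConnectedComponents E => ConnectedComponents.surjective_coe q
  refine ⟨fun j => Subtype.val '' connectedComponent (r (Function.invFun e j)),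
    fun j => isPreconnected_connectedComponent.image _ continuous_subtype_val.continuousOn,
    fun j => ⟨_, mem_image_of_mem _ mem_connectedComponent⟩, ?_⟩
  refine Subset.antisymm (fun x hx => ?_) (iUnion_subset fun j => ?_)
  · obtain ⟨j, hj⟩ := hsurj ((⟨x, hx⟩ : E) : ConnectedComponents E)
    refine mem_iUnion.2 ⟨j, ⟨x, hx⟩, ?_, rfl⟩
    have h := hr (Function.invFun e j)
    rw [hj] at h ⊢
    exact ConnectedComponents.coe_eq_coe'.1 h.symm
  · rintro _ ⟨x, _, rfl⟩
    exact x.2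

/-- Each piece lies in one component and every component contains a piece; pieces may have merged in
the limit. -/
theorem card_connectedComponents_le {X : Type*} [TopologicalSpace X] {E : Set X} {n : ℕ}
    {c : Fin n → Set X} (hc : ∀ j, IsPreconnected (c j)) (hne : ∀ j, (c j).Nonempty)
    (hE : E = ⋃ j, c j) : ENat.card (ConnectedComponents E) ≤ (n : ℕ∞) := by
  choose p hp using hne
  have hcE : ∀ j, c j ⊆ E := fun j => hE ▸ subset_iUnion c j
  let f : Fin n → ConnectedComponents E := fun j => ((⟨p j, hcE j (hp j)⟩ : E) : _)
  have hf : Function.Surjective f := by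
    intro q
    obtain ⟨x, rfl⟩ := ConnectedComponents.surjective_coe q
    obtain ⟨j, hj⟩ := mem_iUnion.1 (hE.subset x.2)
    refine ⟨j, ?_⟩
    have hpre : IsPreconnected (Subtype.val ⁻¹' c j : Set E) := by
      rw [← Topology.IsInducing.subtypeVal.isPreconnected_image, Subtype.image_preimage_coe,
        inter_eq_right.2 (hcE j)]
      exact hc j
    exact ConnectedComponents.coe_eq_coe'.2 (hpre.subset_connectedComponent hj (hp j))
  have := ENat.card_le_card_of_injective (Function.injective_surjInv hf)
  rwa [ENat.card_eq_coe_fintype_card (α := Fin n), Fintype.card_fin] at this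

/-! ### Lower bounds for the energy -/

theorem norm_normal (E : Set Plane) (x : Plane) : ‖normal E x‖ = 1 := by
  rw [normal]
  split_ifs with h h'
  · exact h.choose_spec.1
  · exact h'.choose_spec.1
  · simp

theorem le_psi {φi φj φij : Plane → Plane → ℝ} {c : ℝ} {x : Plane} (hc : 0 ≤ c)
    (hi : ∀ ξ, c * ‖ξ‖ ≤ φi x ξ) (hj : ∀ ξ, c * ‖ξ‖ ≤ φj x ξ) (hij : ∀ ξ, c * ‖ξ‖ ≤ φij x ξ)
    (Sj Si : Set Plane) : c ≤ psi φi φj φij Sj Si x := by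
  have hn : ∀ (φ : Plane → Plane → ℝ) (E : Set Plane), (∀ ξ, c * ‖ξ‖ ≤ φ x ξ) →
      c ≤ φ x (normal E x) := fun φ E h => by
    simpa [norm_normal] using h (normal E x)
  have h1 := hn φi Sj hi
  have h2 := hn φj Sj hj
  have h3 := hn φij Sj hij
  have h4 := hn φij Si hij
  have h5 : c ≤ tension1 φi φj φij x (normal Sj x) := le_min h1 (by linarith)
  have h6 : c ≤ tension2 φi φj x (normal Sj x) := le_min h1 h2
  rw [psi]
  split_ifs <;> linarith

theorem mul_hausdorffMeasure_le_pairEnergy {l L : ℝ} {φi φj φij : Plane → Plane → ℝ} {c : ℝ}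
    (hc : 0 ≤ c) (hi : ∀ x ∈ Omega l L, ∀ ξ, c * ‖ξ‖ ≤ φi x ξ)
    (hj : ∀ x ∈ Omega l L, ∀ ξ, c * ‖ξ‖ ≤ φj x ξ)
    (hij : ∀ x ∈ Omega l L, ∀ ξ, c * ‖ξ‖ ≤ φij x ξ) (Sj Si : Set Plane) :
    ENNReal.ofReal c * H1 (Omega l L ∩ (frontier Si ∪ frontier Sj)) ≤
      pairEnergy l L φi φj φij Sj Si := by
  rw [pairEnergy, ← setLIntegral_const]
  refine setLIntegral_mono' ((isOpen_Omega l L).measurableSet.inter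
    (isClosed_frontier.measurableSet.union isClosed_frontier.measurableSet)) fun x hx => ?_
  exact ENNReal.ofReal_le_ofReal (le_psi hc (hi x hx.1) (hj x hx.1) (hij x hx.1) Sj Si)

/-- As `α ≥ 1`, every layer belongs to a pair of consecutive layers, and such pairs contribute to
both energies. -/
theorem AdmissibleTensions.exists_mul_le {l L : ℝ} {α : ℕ} (hα : 1 ≤ α)
    {φ : Fin (α + 1) → Plane → Plane → ℝ} {φφ : Fin (α + 1) → Fin (α + 1) → Plane → Plane → ℝ}
    (hφ : AdmissibleTensions l L φ φφ) :
    ∃ c > 0, ∀ (σ : Interaction) (S : Fin (α + 1) → Set Plane) (i : Fin (α + 1)),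
      ENNReal.ofReal c * H1 (Omega l L ∩ frontier (S i)) ≤ surfaceEnergy l L φ φφ σ S := by
  obtain ⟨c, c₂, hc, _, hv, hint⟩ := hφ.bounds
  refine ⟨c, hc, fun σ S i => ?_⟩
  obtain ⟨j, hj⟩ : ∃ j : Fin α, i = j.castSucc ∨ i = j.succ := by
    rcases Fin.eq_zero_or_eq_succ i with rfl | ⟨j, rfl⟩
    · exact ⟨⟨0, hα⟩, Or.inl rfl⟩
    · exact ⟨j, Or.inr rfl⟩
  have hlt : j.castSucc < j.succ := Fin.castSucc_lt_succ
  have hpair := mul_hausdorffMeasure_le_pairEnergy hc.le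
    (fun x hx ξ => (hv j.castSucc x (subset_closure hx) ξ).1)
    (fun x hx ξ => (hv j.succ x (subset_closure hx) ξ).1)
    (fun x hx ξ => ((hint _ _ hlt).1 x (subset_closure hx) ξ).1) (S j.succ) (S j.castSucc)
  have hsub : Omega l L ∩ frontier (S i) ⊆
      Omega l L ∩ (frontier (S j.castSucc) ∪ frontier (S j.succ)) := by
    refine inter_subset_inter_right _ ?_
    rcases hj with rfl | rfl
    exacts [subset_union_left, subset_union_right]
  refine (mul_le_mul_right (measure_mono hsub) _).trans (hpair.trans ?_)
  cases σ with
  | sequential =>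
    exact Finset.single_le_sum (f := fun j : Fin α => pairEnergy l L (φ j.castSucc) (φ j.succ)
      (φφ j.castSucc j.succ) (S j.succ) (S j.castSucc)) (fun _ _ => zero_le) (Finset.mem_univ j)
  | total =>
    refine le_trans ?_ (Finset.single_le_sum (f := fun j : Fin (α + 1) =>
      ∑ i ∈ Finset.univ.filter (fun i => i < j), pairEnergy l L (φ i) (φ j) (φφ i j) (S j) (S i))
      (fun _ _ => zero_le) (Finset.mem_univ j.succ))
    exact Finset.single_le_sum (f := fun i : Fin (α + 1) =>
      pairEnergy l L (φ i) (φ j.succ) (φφ i j.succ) (S j.succ) (S i)) (fun _ _ => zero_le)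
      (Finset.mem_filter.2 ⟨Finset.mem_univ _, hlt⟩)

/-! ### Bounds for admissible multilayers -/

theorem subset_lowerBox {l L R : ℝ} (hl : 0 < l) {A : Set Plane} (hA : A ⊆ closure (Omega l L))
    (hR : ∀ p ∈ A, p 1 ≤ R) : A ⊆ lowerBox l L R := by
  intro p hp
  have h := hA hp
  rw [closure_Omega hl] at h
  exact ⟨⟨h.1, h.2.1⟩, h.2.2, hR p hp⟩

theorem closure_subset_last {l L : ℝ} (hl : 0 < l) (hL : 0 < L) {Λ : ℝ≥0∞} {α : ℕ}
    {S : Fin (α + 1) → Set Plane} (hS : S ∈ multilayers l L Λ α) (i : Fin (α + 1)) :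
    closure (S i) ⊆ closure (S (Fin.last α)) := by
  have hmono : Monotone fun i => closure (S i) := by
    refine Fin.monotone_iff_le_succ.2 fun i => ?_
    obtain ⟨h₁, K₁, h₀, K₀, H₁, H₀, e₁, e₀, hle, _⟩ := hS.2 i
    simp only [e₁, e₀, H₁.closure_eq hl hL, H₀.closure_eq hl hL]
    rintro p ⟨hp, hpΩ⟩
    exact ⟨⟨hp.1, hp.2.1, hp.2.2.trans (hle _ ⟨hp.1, hp.2.1⟩)⟩, hpΩ⟩
  exact hmono (Fin.le_last i)

/-- The energy does not see the lateral walls, so `height_le` controls `h` only over `(-l, l)`. For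
`Λ = ⊤` the absence of wall filaments carries the bound to the closure. -/
theorem closure_subset_lowerBox {l L : ℝ} (hl : 0 < l) (hL : 0 < L) {Λ : ℝ≥0∞} {S : Set Plane}
    (hS : S ∈ admissibleSubgraphs l L Λ) {M V : ℝ} (hM0 : 0 ≤ M) (hV0 : 0 ≤ V)
    (hΛ : Λ ≠ ⊤ ∨ S ⊆ closure (S ∩ Omega l L))
    (hM : H1 (Omega l L ∩ frontier S) ≤ ENNReal.ofReal M) (hV : volume S ≤ ENNReal.ofReal V) :
    closure S ⊆ lowerBox l L (max Λ.toReal (2 * M + V / l)) := by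
  obtain ⟨h, K, H, rfl⟩ := hS
  have hcl := H.closure_eq hl hL
  have hh : ∀ x ∈ Icc (-l) l, 0 ≤ h x := fun x hx => (H.1.1 x hx).1
  refine subset_lowerBox hl (hcl.trans_subset inter_subset_right) ?_
  rcases hΛ with hΛ | hΛ
  · intro p hp
    rw [hcl, mem_subgraph_inter hl] at hp
    have h1 := (H.1.1 _ hp.1).2
    rw [ENNReal.ofReal_le_iff_le_toReal hΛ] at h1
    exact (hp.2.2.trans h1).trans (le_max_left _ _)
  · have hclosed : IsClosed {p : Plane | p 1 ≤ max Λ.toReal (2 * M + V / l)} :=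
      isClosed_le (continuous_coord 1) continuous_const
    refine (closure_minimal hΛ isClosed_closure).trans (closure_minimal ?_ hclosed)
    rintro p ⟨hp, hpΩ⟩
    have hpA := subset_closure hp
    rw [hcl, mem_subgraph_inter hl] at hpA
    refine (hpA.2.2.trans ?_).trans (le_max_right _ _)
    refine height_le hl hL hh H.isClosed hM0 hV0 (le_trans (measure_mono ?_) hM)
      (H.volume_eq ▸ hV) ⟨hpΩ.1, hpΩ.2.1⟩
    rw [← hcl]
    exact inter_subset_inter_right _ frontier_closure_subset

/-! ### Recognizing subgraphs -/

/-- The height is the supremum of each vertical slice. Compactness of `A` gives upper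
semicontinuity, and the finite length of its frontier gives bounded variation. -/
theorem exists_height {l L R : ℝ} {Λ : ℝ≥0∞} (hl : 0 < l) (hL : 0 < L) {A : Set Plane}
    (hA : IsClosed A) (hAR : A ⊆ lowerBox l L R) (hA0 : lowerBox l L 0 ⊆ A)
    (hdown : ∀ p ∈ A, ∀ y, -L ≤ y → y ≤ p 1 → !₂[p 0, y] ∈ A)
    (hΛ : ∀ p ∈ A, ENNReal.ofReal (p 1) ≤ Λ) (hfin : H1 (frontier A) ≠ ⊤) :
    ∃ h, IsHeight l Λ h ∧ subgraph l h ∩ closure (Omega l L) = A := by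
  have hAc : IsCompact A := (isCompact_lowerBox l L R).of_isClosed_subset hA hAR
  let h : ℝ → ℝ := fun x => sSup {y | !₂[x, y] ∈ A}
  have hbdd : ∀ x, BddAbove {y | !₂[x, y] ∈ A} := fun x =>
    ⟨R, fun y hy => by simpa using (hAR hy).2.2⟩
  have hzero : ∀ x ∈ Icc (-l) l, (0 : ℝ) ∈ {y | !₂[x, y] ∈ A} := fun x hx =>
    hA0 ⟨by simpa using hx, by simpa using hL.le⟩
  have hmem : ∀ x ∈ Icc (-l) l, !₂[x, h x] ∈ A := by
    intro x hx
    have hcl : IsClosed {y : ℝ | !₂[x, y] ∈ A} := by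
      refine hA.preimage (LipschitzWith.of_dist_le_mul (K := 1) fun s t => ?_).continuous
      rw [dist_vertical, NNReal.coe_one, one_mul, Real.dist_eq]
    exact hcl.csSup_mem ⟨0, hzero x hx⟩ (hbdd x)
  have hle : ∀ p ∈ A, p 1 ≤ h (p 0) := fun p hp =>
    le_csSup (hbdd (p 0)) (show !₂[p 0, p 1] ∈ A from eq_vec p ▸ hp)
  have heq : subgraph l h ∩ closure (Omega l L) = A := by
    ext p
    rw [mem_subgraph_inter hl]
    constructor
    · rintro ⟨h0, h1⟩
      have := hdown _ (hmem _ h0) (p 1) h1.1 (by simpa using h1.2)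
      rw [eq_vec p]
      simpa using this
    · intro hp
      exact ⟨(hAR hp).1, (hAR hp).2.1, hle p hp⟩
  have hnn : ∀ x ∈ Icc (-l) l, 0 ≤ h x := fun x hx => le_csSup (hbdd x) (hzero x hx)
  refine ⟨h, ⟨fun x hx => ⟨hnn x hx, by simpa using hΛ _ (hmem x hx)⟩, ?_, ?_⟩, heq⟩
  · intro x hx c hc
    have hZ : IsClosed ((fun p : Plane => p 0) '' (A ∩ {p | c ≤ p 1})) :=
      ((hAc.inter_right (isClosed_le continuous_const (continuous_coord 1))).image
        (continuous_coord 0)).isClosed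
    have hxZ : x ∉ (fun p : Plane => p 0) '' (A ∩ {p | c ≤ p 1}) := by
      rintro ⟨p, ⟨hp, hpc⟩, rfl⟩
      exact absurd (hle p hp) (not_le.2 (hc.trans_le hpc))
    filter_upwards [mem_nhdsWithin_of_mem_nhds (hZ.isOpen_compl.mem_nhds hxZ),
      self_mem_nhdsWithin] with x' h1 h2
    by_contra! hcon
    exact h1 ⟨_, ⟨hmem x' h2, by simpa using hcon⟩, by simp⟩
  · refine boundedVariationOn_height hl hL hnn ?_ ?_ <;> rwa [heq]

theorem KuratowskiLim.mapsTo {X : Type*} [TopologicalSpace X] {E : ℕ → Set X} {F : Set X}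
    (h : KuratowskiLim E F) {Φ : X → X} (hΦ : Continuous Φ) (hE : ∀ k, MapsTo Φ (E k) (E k)) :
    MapsTo Φ F F := by
  intro x hx
  by_contra hcon
  obtain ⟨U, hU, hev⟩ := h.2 _ hcon
  obtain ⟨k, ⟨z, hz, hzU⟩, hk⟩ := ((h.1 x hx _ (hΦ.continuousAt.preimage_mem_nhds hU)).and hev).exists
  exact (hk ▸ (⟨hE k hz, hzU⟩ : Φ z ∈ E k ∩ U) : Φ z ∈ (∅ : Set X))

theorem KuratowskiLim.union_eq_univ {X : Type*} [TopologicalSpace X] {A C : ℕ → Set X}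
    {A' C' : Set X} (hA : KuratowskiLim A A') (hC : KuratowskiLim C C')
    (hU : ∀ k, A k ∪ C k = univ) : A' ∪ C' = univ := by
  refine eq_univ_of_forall fun x => ?_
  by_contra hx
  rw [mem_union, not_or] at hx
  obtain ⟨U, hxU, hU1⟩ := hA.2 x hx.1
  obtain ⟨V, hxV, hV1⟩ := hC.2 x hx.2
  obtain ⟨k, h1, h2⟩ := (hU1.and hV1).exists
  have hmem : x ∈ A k ∪ C k := hU k ▸ mem_univ x
  rcases hmem with h | h
  · exact (h1 ▸ (⟨h, mem_of_mem_nhds hxU⟩ : x ∈ A k ∩ U) : x ∈ (∅ : Set X))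
  · exact (h2 ▸ (⟨h, mem_of_mem_nhds hxV⟩ : x ∈ C k ∩ V) : x ∈ (∅ : Set X))

/-- Limits of the closures of admissible subgraphs. -/
theorem exists_height_of_kuratowskiLim {l L R : ℝ} {Λ : ℝ≥0∞} (hl : 0 < l) (hL : 0 < L)
    {S : ℕ → Set Plane} (hS : ∀ k, S k ∈ admissibleSubgraphs l L Λ)
    (hR : ∀ k, closure (S k) ⊆ lowerBox l L R) {A : Set Plane}
    (hA : KuratowskiLim (fun k => closure (S k)) A) (hfin : H1 (frontier A) ≠ ⊤) :
    ∃ h, IsHeight l Λ h ∧ subgraph l h ∩ closure (Omega l L) = A := by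
  choose h K H hSK using hS
  have hcl : ∀ k, closure (S k) = subgraph l (h k) ∩ closure (Omega l L) := fun k => by
    rw [hSK k, (H k).closure_eq hl hL]
  refine exists_height hl hL hA.isClosed
    (hA.subset (isCompact_lowerBox l L R).isClosed hR) (hA.subset_of_forall_subset fun k p hp => ?_)
    (fun p hp y hy hyp => ?_) (fun p hp => ?_) hfin
  · rw [hcl, mem_subgraph_inter hl]
    exact ⟨hp.1, hp.2.1, hp.2.2.trans ((H k).1.1 _ hp.1).1⟩
  -- Truncation at level `y ≥ -L` is continuous and preserves every truncated subgraph, hence also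
  -- the limit.
  · have hΦ : Continuous fun w : Plane => (!₂[w 0, min (w 1) y] : Plane) := by
      refine (PiLp.continuous_toLp 2 _).comp (continuous_pi fun i => ?_)
      fin_cases i
      · exact continuous_coord 0
      · exact (continuous_coord 1).min continuous_const
    have := hA.mapsTo hΦ (fun k w hw => ?_) hp
    · simpa [min_eq_right hyp] using this
    · rw [hcl, mem_subgraph_inter hl] at hw ⊢
      refine ⟨by simpa using hw.1, ?_⟩
      simp only [Matrix.cons_val_one, Matrix.cons_val_fin_one, Matrix.cons_val_zero]
      exact ⟨le_min hw.2.1 hy, (min_le_left _ _).trans hw.2.2⟩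
  · have hclosed : IsClosed {p : Plane | ENNReal.ofReal (p 1) ≤ Λ} :=
      isClosed_le (ENNReal.continuous_ofReal.comp (continuous_coord 1)) continuous_const
    refine hA.subset hclosed (fun k q hq => ?_) hp
    rw [hcl, mem_subgraph_inter hl] at hq
    exact (ENNReal.ofReal_le_ofReal hq.2.2).trans ((H k).1.1 _ hq.1).2

/-- The crack set determined by the closure `A` of a composite and the complement `C` of its
interior. -/
theorem isHeightCrack_of_boundary {l L : ℝ} {Λ : ℝ≥0∞} (hl : 0 < l) (hL : 0 < L) {h : ℝ → ℝ}
    (hh : IsHeight l Λ h) {A C : Set Plane} (hA : subgraph l h ∩ closure (Omega l L) = A)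
    (hC : IsClosed C) (hAC : A ∪ C = univ) (hrect : ∀ K ⊆ A ∩ C, IsH1Rectifiable K) :
    IsHeightCrack l L Λ h (A ∩ C ∩ closure (interior (subgraph l h))) ∧
    closure (crackedSubgraph l L h (A ∩ C ∩ closure (interior (subgraph l h)))) = A ∧
    interior (crackedSubgraph l L h (A ∩ C ∩ closure (interior (subgraph l h)))) = Cᶜ := by
  have hAcl : IsClosed A := by
    rw [← hA]
    exact (isClosed_subgraph hh.2.1).inter isClosed_closure
  have H : IsHeightCrack l L Λ h (A ∩ C ∩ closure (interior (subgraph l h))) := by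
    refine ⟨hh, ⟨fun p hp => ?_, (hAcl.inter hC).inter isClosed_closure,
      hrect _ inter_subset_left⟩, inter_subset_right⟩
    have := hp.1.1
    rw [← hA] at this
    exact this.2
  refine ⟨H, (H.closure_eq hl hL).trans hA, ?_⟩
  rw [H.interior_eq, hA]
  have hCA : Cᶜ ⊆ interior A := by
    refine interior_maximal (fun x hx => ?_) hC.isOpen_compl
    exact (hAC ▸ mem_univ x : x ∈ A ∪ C).resolve_right hx
  ext x
  constructor
  · rintro ⟨hx, hxK⟩ hxC
    -- A point of `interior A` lies in the interior of the subgraph, so restricting the crack to the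
    -- closure of that interior removes nothing from `C` there.
    refine hxK ⟨⟨interior_subset hx, hxC⟩, subset_closure (interior_mono ?_ hx)⟩
    rw [← hA]
    exact inter_subset_left
  · intro hx
    exact ⟨hCA hx, fun hxK => hx hxK.1.2⟩

/-! ### Compactness -/

/-- The uniform bounds satisfied by multilayers of bounded energy and area. -/
theorem exists_uniform_bounds {l L : ℝ} (hl : 0 < l) (hL : 0 < L) {Λ : ℝ≥0∞} {α : ℕ} (hα : 1 ≤ α)
    {σ : Interaction} {φ : Fin (α + 1) → Plane → Plane → ℝ}
    {φφ : Fin (α + 1) → Fin (α + 1) → Plane → Plane → ℝ} (hφ : AdmissibleTensions l L φ φφ)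
    {S : ℕ → Fin (α + 1) → Set Plane} (hS : ∀ k, S k ∈ multilayers l L Λ α)
    (hΛ : Λ ≠ ⊤ ∨ ∀ k, S k (Fin.last α) ⊆ closure (S k (Fin.last α) ∩ Omega l L))
    (hbound : (⨆ k, (surfaceEnergy l L φ φφ σ (S k) + volume (S k (Fin.last α)))) < ⊤) :
    ∃ (R : ℝ) (N : ℝ≥0∞), N ≠ ⊤ ∧ (∀ k i, closure (S k i) ⊆ lowerBox l L R) ∧
      ∀ k i, H1 (frontier (S k i)) ≤ N := by
  obtain ⟨c, hc, hcE⟩ := hφ.exists_mul_le hα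
  set B := ⨆ k, (surfaceEnergy l L φ φφ σ (S k) + volume (S k (Fin.last α))) with hB
  have hk : ∀ k, surfaceEnergy l L φ φφ σ (S k) + volume (S k (Fin.last α)) ≤ B := fun k =>
    le_iSup (fun k => surfaceEnergy l L φ φφ σ (S k) + volume (S k (Fin.last α))) k
  have hH : ∀ k i, H1 (Omega l L ∩ frontier (S k i)) ≤ ENNReal.ofReal (B.toReal / c) := by
    intro k i
    have h1 := (hcE σ (S k) i).trans (le_self_add.trans (hk k))
    rw [ENNReal.ofReal_div_of_pos hc, ENNReal.ofReal_toReal hbound.ne,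
      ENNReal.le_div_iff_mul_le (Or.inl (ENNReal.ofReal_pos.2 hc).ne')
        (Or.inl ENNReal.ofReal_ne_top), mul_comm]
    exact h1
  have hV : ∀ k, volume (S k (Fin.last α)) ≤ ENNReal.ofReal B.toReal := fun k => by
    rw [ENNReal.ofReal_toReal hbound.ne]
    exact le_add_self.trans (hk k)
  set R := max Λ.toReal (2 * (B.toReal / c) + B.toReal / l) with hR
  have hbox : ∀ k i, closure (S k i) ⊆ lowerBox l L R := fun k i =>
    (closure_subset_last hl hL (hS k) i).trans
      (closure_subset_lowerBox hl hL ((hS k).1 _) (by positivity) ENNReal.toReal_nonneg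
        (hΛ.imp_right fun h => h k) (hH k _) (hV k))
  -- The second term is the length of the bottom and lateral walls of the box, which the energy does
  -- not charge.
  refine ⟨R, ENNReal.ofReal (B.toReal / c) + H1 (lowerBox l L R \ Omega l L),
    ENNReal.add_ne_top.2 ⟨ENNReal.ofReal_ne_top, hausdorffMeasure_lowerBox_sdiff_ne_top l L R⟩,
    hbox, fun k i => ?_⟩
  calc H1 (frontier (S k i))
      ≤ H1 (Omega l L ∩ frontier (S k i) ∪ lowerBox l L R \ Omega l L) := by
        refine measure_mono fun x hx => ?_
        by_cases hxΩ : x ∈ Omega l L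
        · exact Or.inl ⟨hxΩ, hx⟩
        · exact Or.inr ⟨hbox k i (frontier_subset_closure hx), hxΩ⟩
    _ ≤ _ := (measure_union_le _ _).trans (add_le_add_left (hH k i) _)

theorem lowerBox_zero_subset_closure {l L : ℝ} (hl : 0 < l) (hL : 0 < L) {Λ : ℝ≥0∞}
    {S : Set Plane} (hS : S ∈ admissibleSubgraphs l L Λ) : lowerBox l L 0 ⊆ closure S := by
  obtain ⟨h, K, H, rfl⟩ := hS
  intro p hp
  rw [H.closure_eq hl hL, mem_subgraph_inter hl]
  exact ⟨hp.1, hp.2.1, hp.2.2.trans (H.1.1 _ hp.1).1⟩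

theorem zero_mem_lowerBox {l L : ℝ} (hl : 0 < l) (hL : 0 < L) : (0 : Plane) ∈ lowerBox l L 0 := by
  simp [lowerBox, hl.le, hL.le]

theorem frontier_nonempty_of_subset_lowerBox {l L R : ℝ} {S : Set Plane} (hS : S.Nonempty)
    (hR : S ⊆ lowerBox l L R) : (frontier S).Nonempty := by
  refine nonempty_frontier_iff.2 ⟨hS, ?_⟩
  rintro rfl
  have := (hR (mem_univ (!₂[0, R + 1] : Plane))).2.2
  simp at this
  linarith

theorem exists_tauConverges_subseq {l L R : ℝ} (hl : 0 < l) (hL : 0 < L) {Λ : ℝ≥0∞} {α : ℕ}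
    {m : Fin (α + 1) → ℕ} {S : ℕ → Fin (α + 1) → Set Plane}
    (hS : ∀ k, S k ∈ connMultilayers l L Λ α m) {N : ℝ≥0∞} (hN : N ≠ ⊤)
    (hbox : ∀ k i, closure (S k i) ⊆ lowerBox l L R) (hfr : ∀ k i, H1 (frontier (S k i)) ≤ N) :
    ∃ T ∈ connMultilayers l L Λ α m, ∃ θ : ℕ → ℕ, StrictMono θ ∧
      TauConverges (fun n => S (θ n)) T := by
  have hadm : ∀ k i, S k i ∈ admissibleSubgraphs l L Λ := fun k => (hS k).1.1
  have hne : ∀ k i, (S k i).Nonempty := fun k i => closure_nonempty_iff.1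
    ⟨0, lowerBox_zero_subset_closure hl hL (hadm k i) (zero_mem_lowerBox hl hL)⟩
  choose c hcc hcne hcU using fun k i => exists_preconnected_cover
    (frontier_nonempty_of_subset_lowerBox (hne k i) (subset_closure.trans (hbox k i)))
    ((hS k).2 i)
  have hcsub : ∀ k i j, c k i j ⊆ frontier (S k i) := fun k i j => by
    rw [hcU k i]
    exact subset_iUnion _ j
  obtain ⟨θ, F, hθ, hF⟩ := exists_subseq_kuratowskiLim
    (fun (k : ℕ) (q : (Fin (α + 1) ⊕ Fin (α + 1)) ⊕ (Σ i, Fin (m i))) =>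
      Sum.elim (Sum.elim (fun i => closure (S k i)) fun i => (interior (S k i))ᶜ)
        (fun ij : Σ i, Fin (m i) => c k ij.1 ij.2) q)
  set A : Fin (α + 1) → Set Plane := fun i => F (Sum.inl (Sum.inl i)) with hAdef
  set C : Fin (α + 1) → Set Plane := fun i => F (Sum.inl (Sum.inr i)) with hCdef
  set G : (i : Fin (α + 1)) → Fin (m i) → Set Plane := fun i j => F (Sum.inr ⟨i, j⟩) with hGdef
  have hA : ∀ i, KuratowskiLim (fun k => closure (S (θ k) i)) (A i) := fun i =>
    hF (Sum.inl (Sum.inl i))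
  have hC : ∀ i, KuratowskiLim (fun k => (interior (S (θ k) i))ᶜ) (C i) := fun i =>
    hF (Sum.inl (Sum.inr i))
  have hG : ∀ i j, KuratowskiLim (fun k => c (θ k) i j) (G i j) := fun i j => hF (Sum.inr ⟨i, j⟩)
  have hQ := isCompact_lowerBox l L R
  have hcQ : ∀ k i j, c k i j ⊆ lowerBox l L R := fun k i j =>
    (hcsub k i j).trans (frontier_subset_closure.trans (hbox k i))
  have huniv : ∀ k i, closure (S k i) ∪ (interior (S k i))ᶜ = univ := fun k i => by
    refine eq_univ_of_forall fun x => ?_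
    by_cases hx : x ∈ interior (S k i)
    exacts [Or.inl (subset_closure (interior_subset hx)), Or.inr hx]
  have hfront : ∀ i, KuratowskiLim (fun k => frontier (S (θ k) i)) (A i ∩ C i) := fun i =>
    (hA i).inter (hC i) (fun _ => isClosed_closure) (fun _ => isOpen_interior.isClosed_compl)
      fun k => huniv _ _
  have hAC : ∀ i, A i ∪ C i = univ := fun i => (hA i).union_eq_univ (hC i) fun k => huniv _ _
  have hGU : ∀ i, A i ∩ C i = ⋃ j, G i j := fun i =>
    KuratowskiLim.iUnion (hG i) (hfront i) fun k => hcU _ _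
  have hGc : ∀ i j, IsCompact (G i j) := fun i j =>
    hQ.of_isClosed_subset (hG i j).isClosed ((hG i j).subset hQ.isClosed fun k => hcQ _ _ _)
  have hGp : ∀ i j, IsPreconnected (G i j) := fun i j =>
    (hG i j).isPreconnected hQ (fun k => hcQ _ _ _) fun k => hcc _ _ _
  have hGfin : ∀ i j, H1 (G i j) ≠ ⊤ := fun i j =>
    (hG i j).hausdorffMeasure_ne_top (fun k => hcc _ _ _) hN fun k =>
      (measure_mono (hcsub _ _ _)).trans (hfr _ _)
  have hGne : ∀ i j, (G i j).Nonempty := fun i j =>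
    (hG i j).nonempty hQ (fun k => hcQ _ _ _) fun k => hcne _ _ _
  have hrect : ∀ i, ∀ K ⊆ A i ∩ C i, IsH1Rectifiable K := fun i K hK =>
    isH1Rectifiable_of_subset_iUnion (hGc i) (hGp i) (hGfin i) (hGU i ▸ hK)
  -- The inclusion can be strict: `A ∩ C` also contains the cracks, which the closure `A` forgets.
  have hAfr : ∀ i, frontier (A i) ⊆ A i ∩ C i := fun i x hx => by
    refine ⟨(hA i).isClosed.frontier_subset hx, ?_⟩
    by_contra hxC
    refine hx.2 (interior_maximal (fun y hy => ?_) (hC i).isClosed.isOpen_compl hxC)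
    exact (hAC i ▸ mem_univ y : y ∈ A i ∪ C i).resolve_right hy
  have hAfin : ∀ i, H1 (frontier (A i)) ≠ ⊤ := fun i => (hrect i _ (hAfr i)).1.ne
  choose h hh hhA using fun i => exists_height_of_kuratowskiLim hl hL (fun k => hadm (θ k) i)
    (fun k => hbox (θ k) i) (hA i) (hAfin i)
  have hcrack := fun i => isHeightCrack_of_boundary hl hL (hh i) (hhA i) (hC i).isClosed (hAC i)
    (hrect i)
  set T : Fin (α + 1) → Set Plane := fun i =>
    crackedSubgraph l L (h i) (A i ∩ C i ∩ closure (interior (subgraph l (h i)))) with hT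
  have hTcl : ∀ i, closure (T i) = A i := fun i => (hcrack i).2.1
  have hTint : ∀ i, interior (T i) = (C i)ᶜ := fun i => (hcrack i).2.2
  have hTfr : ∀ i, frontier (T i) = A i ∩ C i := fun i => by
    rw [frontier, hTcl, hTint, sdiff_compl]
  have hA0 : ∀ i, (0 : Plane) ∈ A i := fun i =>
    (hA i).subset_of_forall_subset (fun k => lowerBox_zero_subset_closure hl hL (hadm _ _))
      (zero_mem_lowerBox hl hL)
  have hTne : ∀ i, (T i).Nonempty := fun i => closure_nonempty_iff.1 (hTcl i ▸ ⟨0, hA0 i⟩)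
  have hTfrne : ∀ i, (frontier (T i)).Nonempty := fun i =>
    frontier_nonempty_of_subset_lowerBox (hTne i)
      (subset_closure.trans (hTcl i ▸ (hA i).subset hQ.isClosed fun k => hbox _ _))
  refine ⟨T, ⟨⟨fun i => ⟨_, _, (hcrack i).1, rfl⟩, fun i => ?_⟩, fun i => ?_⟩, θ, hθ,
    fun i => ?_, fun i => ?_⟩
  · refine ⟨_, _, _, _, (hcrack i.succ).1, (hcrack i.castSucc).1, rfl, rfl, fun x hx => ?_, ?_⟩
    · have hmono : A i.castSucc ⊆ A i.succ := by
        refine (hA _).mono (hA _) fun k => ?_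
        obtain ⟨h₁, K₁, h₀, K₀, H₁, H₀, e₁, e₀, hle, _⟩ := (hS (θ k)).1.2 i
        rw [e₁, e₀, H₁.closure_eq hl hL, H₀.closure_eq hl hL]
        rintro p ⟨hp, hpΩ⟩
        exact ⟨⟨hp.1, hp.2.1, hp.2.2.trans (hle _ ⟨hp.1, hp.2.1⟩)⟩, hpΩ⟩
      have h0 := ((hh i.castSucc).1 x hx).1
      -- The order of the heights is read off at the top point of the lower subgraph.
      have hmem : (!₂[x, h i.castSucc x] : Plane) ∈ A i.castSucc := by
        rw [← hhA, mem_subgraph_inter hl]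
        refine ⟨by simpa using hx, ?_⟩
        simp only [Matrix.cons_val_one, Matrix.cons_val_fin_one, Matrix.cons_val_zero]
        exact ⟨by linarith, le_rfl⟩
      have := hmono hmem
      rw [← hhA, mem_subgraph_inter hl] at this
      simpa using this.2.2
    · rw [hTfr, hTint, eq_empty_iff_forall_notMem]
      rintro x ⟨hx, hxC⟩
      -- A point outside `C i.castSucc` has a neighbourhood eventually inside the interiors of the
      -- lower composites, while boundaries of the upper ones accumulate at `x`; this contradicts
      -- the constraint on `S (θ k)`.
      obtain ⟨U, hU, hev⟩ := (hC i.castSucc).2 x hxC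
      obtain ⟨k, ⟨z, hz, hzU⟩, hk⟩ := (((hfront i.succ).1 x hx U hU).and hev).exists
      obtain ⟨_, _, _, _, _, _, _, _, _, hemp⟩ := (hS (θ k)).1.2 i
      have hzi : z ∈ interior (S (θ k) i.castSucc) := by
        by_contra hcon
        exact (hk ▸ (⟨hcon, hzU⟩ : z ∈ (interior (S (θ k) i.castSucc))ᶜ ∩ U) : z ∈ (∅ : Set Plane))
      exact (hemp ▸ (⟨hz, hzi⟩ : z ∈ frontier (S (θ k) i.succ) ∩ interior (S (θ k) i.castSucc)) :
        z ∈ (∅ : Set Plane))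
  · exact card_connectedComponents_le (hGp i) (hGne i) ((hTfr i).trans (hGU i))
  · exact lt_of_le_of_lt (iSup_le fun k => hfr _ _) hN.lt_top
  · refine tendstoLocallyUniformly_sdist (by rw [hTcl]; exact hA i)
      (by rw [hTint, compl_compl]; exact hC i) (hTne i) ?_
    exact (hTfrne i).mono fun x hx => hx.2

end Multilayer

theorem mainTheorem7 (l L : ℝ) (hl : 0 < l) (hL : 0 < L) (Λ : ℝ≥0∞)
    (α : ℕ) (hα : 1 ≤ α) (m : Fin (α + 1) → ℕ) (σ : Multilayer.Interaction)
    (φ : Fin (α + 1) → Multilayer.Plane → Multilayer.Plane → ℝ)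
    (φφ : Fin (α + 1) → Fin (α + 1) → Multilayer.Plane → Multilayer.Plane → ℝ)
    (hφ : Multilayer.AdmissibleTensions l L φ φφ)
    (S : ℕ → Fin (α + 1) → Set Multilayer.Plane)
    (hS : ∀ k, S k ∈ Multilayer.connMultilayers l L Λ α m)
    (hΛ : Λ ≠ ⊤ ∨
      ∀ k, S k (Fin.last α) ⊆ closure (S k (Fin.last α) ∩ Multilayer.Omega l L))
    (hbound : (⨆ k, (Multilayer.surfaceEnergy l L φ φφ σ (S k) + volume (S k (Fin.last α)))) < ⊤) :
    ∃ T ∈ Multilayer.connMultilayers l L Λ α m, ∃ θ : ℕ → ℕ, StrictMono θ ∧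
      Multilayer.TauConverges (fun n => S (θ n)) T := by
  obtain ⟨R, N, hN, hbox, hfr⟩ :=
    Multilayer.exists_uniform_bounds hl hL hα hφ (fun k => (hS k).1) hΛ hbound
  exact Multilayer.exists_tauConverges_subseq hl hL hS hN hbox hfr
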